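/- Consider best arm identification with $K$ arms. Sampling arm $i$ gives independent $N(P_i,1)$ rewards, and an algorithm with budget $T$ errs if the arm it returns is not the best arm of $\bm P$; write $\mathrm{PoE}(T)$ for the probability of this. Let $\bm P=\bm P^{(K)}$ be the instance $P_1=2$, $P_i=1$ for $2\le i\le\lfloor\log K\rfloor$, and $P_i=0$ for $\lfloor\log K\rfloor<i\le K$. **Notation.** For $\bm Q\in\mathbb R^K$ let $i^*(\bm Q)=\arg\max_i Q_i$ (a set) and $\Delta_i^Q=\max_jQ_j-Q_i$. For $i\notin i^*(\bm Q)$ let $D_i(\bm Q)=(\Delta_i^Q)^2\sum_{j\ne i}(\Delta_j^Q+\Delta_i^Q)^{-2}$; for $i\in i^*(\bm Q)$ let $D_i(\bm Q)=\min_{j\notin i^*(\bm Q)}D_j(\bm Q)$ (and $D_i(\bm Q)=1$ if all arms are tied). Let $Z(\bm Q)=\sum_i1/D_i(\bm Q)$, $w^\star_i(\bm Q)=1/(D_i(\bm Q)Z(\bm Q))$, $H_1(\bm P)=\sum_{i\notin i^*(\bm P)}(\max_jP_j-P_i)^{-2}$ and $S(\bm Q,\bm P)=H_1(\bm P)\sum_i(Q_i-P_i)^2/D_i(\bm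 Q)$. The guaranteed rate of Almost Tracking on $\bm P$ is $$G(\bm P)=\inf_{\bm Q:\,i^*(\bm P)\notin i^*(\bm Q)}\ \sum_{i}w^\star_i(\bm Q)\frac{(Q_i-P_i)^2}{2}.$$ *Almost Tracking* with parameter $C_{\mathrm{suf}}\in(0,1)$, batch size $N$ and budget $T$ uses batches $b=1,\dots,\lfloor T/N\rfloor$ of weights $w_{b,i}$. The first batch has $w_{1,i}=1/K$. For $b\ge2$, with $\bar{\bm Q}_{b-1}$ the empirical means over the first $b-1$ batches, let $\mathcal K_b=\{i:\frac1{b-1}\sum_{b'<b}w_{b',i}\le w^\star_i(\bar{\bm Q}_{b-1})/C_{\mathrm{suf}}\}$, $w_{b,i}=w^\star_i(\bar{\bm Q}_{b-1})/\sum_{j\in\mathcal K_b}w^\star_j(\bar{\bm Q}_{b-1})$ for $i\in\mathcal K_b$, and $w_{b,i}=0$ otherwise. Batch $b$ pulls each arm with $w_{b,i}>0$ exactly $1+\lfloor w_{b,i}(N-\#\{j:w_{b,j}>0\})\rfloor$ times, and the pulls of the batch that are left over are allotted independently at random according to $\bm w_b$. At the end the empirical best arm is returned. *Successive Rejects* (SR)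 with budget $T$ has phases $k=1,\dots,K-1$. In phase $k$ every remaining arm is pulled $n_k-n_{k-1}$ times, where $n_0=0$, $n_k=\big\lceil\frac{T-K}{\overline{\log}(K)\,(K+1-k)}\big\rceil$ and $\overline{\log}(K)=\frac12+\sum_{i=2}^K\frac1i$; then the remaining arm of smallest empirical mean is rejected. The last remaining arm is returned. For $P_1>P_2\ge\dots\ge P_K$ and $2\le j\le K$ let $\mu_j$ be the unique $x$ that equals the average of the means $P_i$, $i\in\{1\}\cup\{2\le i\le j:P_i\le x\}$, and let $$H_3(\bm P)=\max_{2\le j\le K}\frac{2j}{(P_1-\mu_j)^2+\sum_{i=2}^j(\mu_j-P_i)_+^2}.$$ **Statement.** There are a universal constant $c>0$ and $K_0\in\mathbb N$ such that for all $K\ge K_0$ and $\bm P=\bm P^{(K)}$: 1. for every $\bm Q\in\mathbb R^K$ with $i^*(\bm P)\notin i^*(\bm Q)$, $\ S(\bm Q,\bm P)/Z(\bm Q)\ge c/\log\log K$; 2. SR has the positive rate $r_{\mathrm{SR}}:=\lim_{T\to\infty}\frac1T\log\frac1{\mathrm{PoE}_{\mathrm{SR}}(T)}=\frac1{H_3(\bm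 P)\,\overline{\log}(K)}$; 3. the guaranteed rate of Almost Tracking satisfies $\ G(\bm P)\ge c\,\frac{\log K}{\log\log K}\,r_{\mathrm{SR}}$. Moreover, for every $C_{\mathrm{suf}}\in(0,1)$ there is a constant $c'>0$, depending only on $C_{\mathrm{suf}}$, such that for all $K\ge K_0$ and all batch sizes $N=N(T)$ with $N\to\infty$ and $N/T\to0$ as $T\to\infty$, Almost Tracking on $\bm P=\bm P^{(K)}$ satisfies $$\liminf_{T\to\infty}\frac1T\log\frac1{\mathrm{PoE}_{\mathrm{AT}}(T)}\ \ge\ c'\,\frac{\log K}{\log\log K}\,r_{\mathrm{SR}}.$$ -/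

import Mathlib

open MeasureTheory ProbabilityTheory Filter Topology
open scoped ENNReal

noncomputable section

/-! ## Vectors of means: best arms, gaps, complexity measures -/

/-- The set `i*(Q)` of best arms of a vector of means. -/
def bestArms {K : ℕ} (Q : Fin K → ℝ) : Finset (Fin K) :=
  Finset.univ.filter fun i => ∀ j, Q j ≤ Q i

/-- The gap `Δ_i = max_j Q_j - Q_i`. -/
def gap {K : ℕ} (Q : Fin K → ℝ) (i : Fin K) : ℝ :=
  (⨆ j, Q j) - Q i

/-- `i*(P) ∉ i*(Q)`: no best arm of `P` is a best arm of `Q`. -/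
def Misidentified {K : ℕ} (P Q : Fin K → ℝ) : Prop :=
  ∀ i ∈ bestArms P, i ∉ bestArms Q

/-- `H₁(P) = ∑_{i ≠ i*(P)} (P* - P_i)⁻²`. -/
def riskH1 {K : ℕ} (P : Fin K → ℝ) : ℝ :=
  ∑ i ∈ (bestArms P)ᶜ, 1 / gap P i ^ 2

/-- `H₁'(i, Q) = ∑_{j ≠ i} (Δ_j + Δ_i)⁻²`. -/
def riskH1' {K : ℕ} (Q : Fin K → ℝ) (i : Fin K) : ℝ :=
  ∑ j ∈ Finset.univ.erase i, 1 / (gap Q j + gap Q i) ^ 2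

/-- `D_i(Q)`: equal to `Δ_i² H₁'(i, Q)` for an arm that is not a best arm of `Q`, and to the
minimum of these numbers for a best arm. If all arms are tied (no minimum to take), the value
is `1` for all arms. -/
def costD {K : ℕ} (Q : Fin K → ℝ) (i : Fin K) : ℝ :=
  if i ∉ bestArms Q then gap Q i ^ 2 * riskH1' Q i
  else if bestArms Q = Finset.univ then 1
  else ⨅ j : {j : Fin K // j ∉ bestArms Q}, gap Q j ^ 2 * riskH1' Q j

/-- The normalization `Z(Q) = ∑_i 1 / D_i(Q)`. -/
def normZ {K : ℕ} (Q : Fin K → ℝ) : ℝ :=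
  ∑ i, 1 / costD Q i

/-- The allocation `w*_i(Q) = 1 / (D_i(Q) Z(Q))`. -/
def allocStar {K : ℕ} (Q : Fin K → ℝ) (i : Fin K) : ℝ :=
  1 / (costD Q i * normZ Q)

/-- `S(Q, P) = (∑_i (Q_i - P_i)² / D_i(Q)) H₁(P)`. -/
def stblS {K : ℕ} (Q P : Fin K → ℝ) : ℝ :=
  (∑ i, (Q i - P i) ^ 2 / costD Q i) * riskH1 P

/-- The rate guaranteed by an allocation function `w` on the instance `P`: the value
`inf_{Q : i*(P) ∉ i*(Q)} ∑_i w_i(Q) (Q_i - P_i)² / 2`. -/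
def guaranteedRate {K : ℕ} (w : (Fin K → ℝ) → Fin K → ℝ) (P : Fin K → ℝ) : ℝ :=
  ⨅ Q : {Q : Fin K → ℝ // Misidentified P Q}, ∑ i, w Q.1 i * (Q.1 i - P i) ^ 2 / 2

/-! ## The complexity `H₃` (for arms numbered so that `P_1 > P_2 ≥ … ≥ P_K`)

Arm number `i` of the usual numbering `1, …, K` is the element of `Fin K` with value `i - 1`. -/

/-- Arm `1` together with those arms among `2, …, j` whose mean is at most `x`. -/
def topArms {K : ℕ} (P : Fin K → ℝ) (j : ℕ) (x : ℝ) : Finset (Fin K) :=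
  Finset.univ.filter fun i => i.val < j ∧ (i.val = 0 ∨ P i ≤ x)

/-- The modified mean of the top `j` arms: the (unique) number `x` that is the average of the
means of the arms in `topArms P j x`. -/
def modMean {K : ℕ} (P : Fin K → ℝ) (j : ℕ) : ℝ :=
  Classical.epsilon fun x : ℝ => x = (∑ i ∈ topArms P j x, P i) / (topArms P j x).card

/-- `Δ_i^{(j)}`. -/
def modGap {K : ℕ} (P : Fin K → ℝ) (j : ℕ) (i : Fin K) : ℝ :=
  if i.val = 0 then P i - modMean P j else max (modMean P j - P i) 0

/-- `H₃(P) = max_{2 ≤ j ≤ K} 2 j / ∑_{i ≤ j} (Δ_i^{(j)})²`. -/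
def riskH3 {K : ℕ} (P : Fin K → ℝ) : ℝ :=
  ⨆ j : Set.Icc 2 K,
    2 * (j.1 : ℝ) / ∑ i ∈ Finset.univ.filter (fun i : Fin K => i.val < j.1), modGap P j.1 i ^ 2

/-- `1/2 + ∑_{i=2}^K 1/i`. -/
def logBar (K : ℕ) : ℝ :=
  1 / 2 + ∑ i ∈ Finset.Icc 2 K, 1 / (i : ℝ)

/-! ## The Gaussian bandit -/

/-- A table of rewards: `X (b, i, s)` is the reward of the `s`-th pull (counted from `0`) of arm
`i` within stage `b` (counted from `0`) of an algorithm that works in stages. -/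
abbrev RewardTable (K : ℕ) : Type := ℕ × Fin K × ℕ → ℝ

/-- All rewards are independent, and those of arm `i` are Gaussian with mean `P_i`, variance `1`. -/
def rewardLaw {K : ℕ} (P : Fin K → ℝ) : Measure (RewardTable K) :=
  Measure.infinitePi fun k : ℕ × Fin K × ℕ => gaussianReal (P k.2.1) 1

/-- The exponential rate at horizon `T` of probabilities of error `p`, `(1/T) log (1 / p T)`. -/
def errorExponent (p : ℕ → ℝ≥0∞) (T : ℕ) : EReal :=
  ENNReal.log (p T)⁻¹ / (T : EReal)

/-! ## Successive Rejects -/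

/-- `n_k = ⌈(T - K) / (logBar K · (K + 1 - k))⌉` for `k ≥ 1`, and `n_0 = 0`. -/
def srLength (K T k : ℕ) : ℕ :=
  if k = 0 then 0 else ⌈((T : ℝ) - K) / (logBar K * ((K : ℝ) + 1 - k))⌉₊

/-- The empirical mean of an arm that was active in phases `1, …, k`; phase `a` (stage `a - 1`)
pulls it `n_a - n_{a-1}` times. -/
def srMean {K : ℕ} (X : RewardTable K) (T k : ℕ) (i : Fin K) : ℝ :=
  (∑ a ∈ Finset.range k, ∑ s ∈ Finset.range (srLength K T (a + 1) - srLength K T a), X (a, i, s)) /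
    (srLength K T k : ℝ)

/-- The arms that remain after `k` phases. Each phase removes the active arm of smallest empirical
mean (the first such arm in case of a tie). -/
def srActive {K : ℕ} (X : RewardTable K) (T : ℕ) : ℕ → Finset (Fin K)
  | 0 => Finset.univ
  | k + 1 => (srActive X T k).filter fun i => ∃ j ∈ srActive X T k,
      srMean X T (k + 1) j < srMean X T (k + 1) i ∨
        (srMean X T (k + 1) j = srMean X T (k + 1) i ∧ j < i)

/-- The probability that the arm that survives the `K - 1` phases is not a best arm. -/
def srError {K : ℕ} (P : Fin K → ℝ) (T : ℕ) : ℝ≥0∞ :=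
  rewardLaw P {X | ∃ i ∈ srActive X T (K - 1), i ∉ bestArms P}

/-! ## Almost Tracking -/

/-- The deterministic part of the rounding of `w N`: `0` if `w_i = 0`, and otherwise
`1 + ⌊w_i N'⌋` with `N' = N - #{j | w_j > 0}`. -/
def roundBase {K : ℕ} (w : Fin K → ℝ) (N : ℕ) (i : Fin K) : ℕ :=
  if 0 < w i then
    1 + ⌊w i * ((N : ℝ) - (Finset.univ.filter fun j => 0 < w j).card)⌋₊
  else 0

/-- The rounding of `w N` to integer numbers of pulls: the pulls that `roundBase` leaves over are
drawn independently from the distribution `w` on the arms, the `m`-th one by inverting the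
distribution function at the uniform seed `u m`. -/
def roundAlloc {K : ℕ} (w : Fin K → ℝ) (N : ℕ) (u : ℕ → unitInterval) (i : Fin K) : ℕ :=
  roundBase w N i +
    ((Finset.range (N - ∑ j, roundBase w N j)).filter fun m =>
      ∑ j ∈ Finset.univ.filter (fun j => j < i), w j ≤ (u m : ℝ) ∧
        (u m : ℝ) < ∑ j ∈ Finset.univ.filter (fun j => j ≤ i), w j).card

/-- What Almost Tracking has recorded: for every arm the number of pulls, the sum of the rewards,
and the sum of the batch weights `w_{b,i}`, over all past batches. -/
structure ATState (K : ℕ) where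
  pulls : Fin K → ℕ
  total : Fin K → ℝ
  weight : Fin K → ℝ

/-- The empirical means over all past batches. -/
def ATState.mean {K : ℕ} (s : ATState K) (i : Fin K) : ℝ :=
  s.total i / (s.pulls i : ℝ)

/-- The insufficiently drawn arms after `b` batches: those whose average batch weight is at most
`w_i(Q̄_b) / C_suf`. -/
def ATState.insufficient {K : ℕ} (w : (Fin K → ℝ) → Fin K → ℝ) (Csuf : ℝ) (b : ℕ)
    (s : ATState K) : Finset (Fin K) :=
  Finset.univ.filter fun i => s.weight i / (b : ℝ) ≤ 1 / Csuf * w s.mean i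

/-- The weights of the batch that follows `b` completed batches: uniform for the first batch, and
proportional to `w_i(Q̄_b)` on the insufficiently drawn arms for the later ones. -/
def ATState.nextWeight {K : ℕ} (w : (Fin K → ℝ) → Fin K → ℝ) (Csuf : ℝ) (b : ℕ)
    (s : ATState K) (i : Fin K) : ℝ :=
  if b = 0 then 1 / (K : ℝ)
  else if i ∈ s.insufficient w Csuf b then
    w s.mean i / ∑ j ∈ s.insufficient w Csuf b, w s.mean j
  else 0

/-- The record of Almost Tracking after `b` batches of size `N`, for the reward table `X` and the
rounding seeds `U`. -/
def atState {K : ℕ} (w : (Fin K → ℝ) → Fin K → ℝ) (Csuf : ℝ) (N : ℕ)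
    (X : RewardTable K) (U : ℕ × ℕ → unitInterval) : ℕ → ATState K
  | 0 => ⟨fun _ => 0, fun _ => 0, fun _ => 0⟩
  | b + 1 =>
    let s := atState w Csuf N X U b
    let v := s.nextWeight w Csuf b
    let n := roundAlloc v N fun m => U (b, m)
    ⟨fun i => s.pulls i + n i,
      fun i => s.total i + ∑ m ∈ Finset.range (n i), X (b, i, m),
      fun i => s.weight i + v i⟩

/-- The probability that Almost Tracking with batch size `N` does not return a best arm of `P` at
budget `T`, where it has completed `⌊T / N⌋` batches and returns the empirical best arm. A tie
that involves a wrong arm counts as an error, so this bounds every way of breaking ties. -/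
def atError {K : ℕ} (w : (Fin K → ℝ) → Fin K → ℝ) (Csuf : ℝ) (P : Fin K → ℝ) (N T : ℕ) : ℝ≥0∞ :=
  ((rewardLaw P).prod
      (Measure.infinitePi fun _ : ℕ × ℕ => (volume : Measure unitInterval)))
    {ω | ∃ i ∈ bestArms (atState w Csuf N ω.1 ω.2 (T / N)).mean, i ∉ bestArms P}

/-! ## The instance -/

/-- `P_1 = 2`, `P_2 = … = P_{⌊log K⌋} = 1`, and `P_i = 0` for `⌊log K⌋ < i ≤ K`. -/
def logInstance (K : ℕ) (i : Fin K) : ℝ :=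
  if i.val = 0 then 2 else if i.val < ⌊Real.log K⌋₊ then 1 else 0

/-- The rate `1 / (H₃(P) logBar K)`. -/
def srRate {K : ℕ} (P : Fin K → ℝ) : ℝ :=
  1 / (riskH3 P * logBar K)

end

/-! ## Error exponents -/

theorem le_errorExponent {p : ℕ → ℝ≥0∞} {T : ℕ} (hT : 0 < T) {y : ℝ}
    (h : p T ≤ ENNReal.ofReal (Real.exp (-y))) : ((y / T : ℝ) : EReal) ≤ errorExponent p T := by
  have hT' : (0 : EReal) ≤ (T : EReal) := by positivity
  have h1 : ((y : ℝ) : EReal) ≤ ENNReal.log (p T)⁻¹ := by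
    rw [ENNReal.log_inv, EReal.le_neg, ← EReal.coe_neg]
    refine (ENNReal.log_monotone h).trans ?_
    rw [ENNReal.log_ofReal_of_pos (Real.exp_pos _), Real.log_exp]
  rw [EReal.coe_div, errorExponent]
  exact EReal.div_le_div_right_of_nonneg hT' h1

theorem errorExponent_le {p : ℕ → ℝ≥0∞} {T : ℕ} (hT : 0 < T) {y : ℝ}
    (h : ENNReal.ofReal (Real.exp (-y)) ≤ p T) : errorExponent p T ≤ ((y / T : ℝ) : EReal) := by
  have hT' : (0 : EReal) ≤ (T : EReal) := by positivity
  have h1 : ENNReal.log (p T)⁻¹ ≤ ((y : ℝ) : EReal) := by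
    rw [ENNReal.log_inv, EReal.neg_le, ← EReal.coe_neg]
    refine le_trans ?_ (ENNReal.log_monotone h)
    rw [ENNReal.log_ofReal_of_pos (Real.exp_pos _), Real.log_exp]
  rw [EReal.coe_div, errorExponent]
  exact EReal.div_le_div_right_of_nonneg hT' h1

theorem le_liminf_errorExponent {p : ℕ → ℝ≥0∞} {y : ℕ → ℝ} {r : ℝ}
    (h : ∀ᶠ T in atTop, p T ≤ ENNReal.ofReal (Real.exp (-y T)))
    (hy : Tendsto (fun T : ℕ => y T / T) atTop (𝓝 r)) :
    (r : EReal) ≤ liminf (errorExponent p) atTop := by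
  have h1 : Tendsto (fun T : ℕ => ((y T / T : ℝ) : EReal)) atTop (𝓝 (r : EReal)) :=
    (continuous_coe_real_ereal.tendsto r).comp hy
  rw [← h1.liminf_eq]
  refine liminf_le_liminf ?_
  filter_upwards [h, eventually_gt_atTop 0] with T h2 h3 using le_errorExponent h3 h2

theorem limsup_errorExponent_le {p : ℕ → ℝ≥0∞} {y : ℕ → ℝ} {r : ℝ}
    (h : ∀ᶠ T in atTop, ENNReal.ofReal (Real.exp (-y T)) ≤ p T)
    (hy : Tendsto (fun T : ℕ => y T / T) atTop (𝓝 r)) :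
    limsup (errorExponent p) atTop ≤ (r : EReal) := by
  have h1 : Tendsto (fun T : ℕ => ((y T / T : ℝ) : EReal)) atTop (𝓝 (r : EReal)) :=
    (continuous_coe_real_ereal.tendsto r).comp hy
  rw [← h1.limsup_eq]
  refine limsup_le_limsup ?_
  filter_upwards [h, eventually_gt_atTop 0] with T h2 h3 using errorExponent_le h3 h2

/-! ## Sums of rewards -/

instance {K : ℕ} (P : Fin K → ℝ) : IsProbabilityMeasure (rewardLaw P) := by
  unfold rewardLaw; infer_instance

theorem iIndepFun_reward {K : ℕ} (P : Fin K → ℝ) :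
    iIndepFun (fun (k : ℕ × Fin K × ℕ) (X : RewardTable K) => X k) (rewardLaw P) :=
  iIndepFun_infinitePi (P := fun k : ℕ × Fin K × ℕ => gaussianReal (P k.2.1) 1)
    (X := fun _ x => x) (fun _ => measurable_id)

theorem map_reward {K : ℕ} (P : Fin K → ℝ) (k : ℕ × Fin K × ℕ) :
    (rewardLaw P).map (fun X => X k) = gaussianReal (P k.2.1) 1 :=
  Measure.infinitePi_map_eval _ k

theorem hasSubgaussianMGF_reward {K : ℕ} (P : Fin K → ℝ) (k : ℕ × Fin K × ℕ) (c : ℝ) :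
    HasSubgaussianMGF (fun X : RewardTable K => c * (X k - P k.2.1)) (c ^ 2).toNNReal
      (rewardLaw P) := by
  have hc : (c ^ 2).toNNReal = NNReal.mk (c ^ 2) (sq_nonneg c) * 1 := by
    rw [mul_one]; exact Real.toNNReal_of_nonneg (sq_nonneg c)
  rw [hc]
  refine HasSubgaussianMGF.const_mul ?_ c
  have hlaw : (rewardLaw P).map (fun X => X k - P k.2.1) = gaussianReal 0 1 := by
    have h := gaussianReal_map_sub_const (μ := P k.2.1) (v := 1) (P k.2.1)
    rw [← map_reward P k, Measure.map_map (by fun_prop) (by fun_prop)] at h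
    simpa [Function.comp_def] using h
  refine HasSubgaussianMGF.of_map (X := id) (Y := fun X : RewardTable K => X k - P k.2.1)
    (Measurable.aemeasurable (by fun_prop)) ?_
  rw [hlaw]
  refine ⟨fun t => integrable_exp_mul_gaussianReal t, fun t => ?_⟩
  rw [mgf_id_gaussianReal]
  simp

theorem reward_tail {K : ℕ} (P : Fin K → ℝ) (B : ℕ) (ν : ℕ → Fin K → ℕ) (c : Fin K → ℝ)
    {t : ℝ} (ht : 0 ≤ t) :
    rewardLaw P {X | t ≤ ∑ b ∈ Finset.range B, ∑ i, ∑ s ∈ Finset.range (ν b i),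
        c i * (X (b, i, s) - P i)} ≤
      ENNReal.ofReal (Real.exp (-t ^ 2 /
        (2 * ∑ b ∈ Finset.range B, ∑ i, (ν b i : ℝ) * c i ^ 2))) := by
  have hinj : Function.Injective
      (fun q : (_ : ℕ × Fin K) × ℕ => ((q.1.1, q.1.2, q.2) : ℕ × Fin K × ℕ)) := by
    rintro ⟨⟨a, b⟩, d⟩ ⟨⟨a', b'⟩, d'⟩ h
    simp only [Prod.mk.injEq] at h
    obtain ⟨rfl, rfl, rfl⟩ := h
    rfl
  have hind := (iIndepFun_reward P).precomp hinj
  have hind2 := hind.comp (fun q x => c q.1.2 * (x - P q.1.2)) (fun q => by fun_prop)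
  have key := HasSubgaussianMGF.measure_sum_ge_le_of_iIndepFun hind2
    (c := fun q => (c q.1.2 ^ 2).toNNReal)
    (s := (Finset.range B ×ˢ (Finset.univ : Finset (Fin K))).sigma
      fun p => Finset.range (ν p.1 p.2))
    (fun q _ => hasSubgaussianMGF_reward P (q.1.1, q.1.2, q.2) (c q.1.2)) ht
  rw [← ofReal_measureReal]
  refine ENNReal.ofReal_le_ofReal ?_
  simp only [Finset.sum_sigma, Finset.sum_product, Function.comp_def] at key
  refine key.trans (le_of_eq ?_)
  congr 3
  simp [Real.coe_toNNReal _ (sq_nonneg _)]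

/-! ## Gaps and the costs `D_i` -/

section costs

variable {K : ℕ} (Q : Fin K → ℝ)

theorem le_iSup_arm (i : Fin K) : Q i ≤ ⨆ j, Q j :=
  le_ciSup (Set.finite_range Q).bddAbove i

theorem gap_nonneg (i : Fin K) : 0 ≤ gap Q i := sub_nonneg.2 (le_iSup_arm Q i)

theorem mem_bestArms {i : Fin K} : i ∈ bestArms Q ↔ ∀ j, Q j ≤ Q i := by
  simp [bestArms]

theorem mem_bestArms_iff_gap {i : Fin K} : i ∈ bestArms Q ↔ gap Q i = 0 := by
  have : Nonempty (Fin K) := ⟨i⟩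
  rw [mem_bestArms]
  constructor
  · intro h
    exact le_antisymm (sub_nonpos.2 (ciSup_le h)) (gap_nonneg Q i)
  · intro h j
    have := le_iSup_arm Q j
    unfold gap at h
    linarith

theorem gap_pos {i : Fin K} (hi : i ∉ bestArms Q) : 0 < gap Q i :=
  lt_of_le_of_ne (gap_nonneg Q i) fun h => hi ((mem_bestArms_iff_gap Q).2 h.symm)

theorem bestArms_nonempty (i : Fin K) : (bestArms Q).Nonempty := by
  have : Nonempty (Fin K) := ⟨i⟩
  obtain ⟨m, hm⟩ := Finite.exists_max Q
  exact ⟨m, (mem_bestArms Q).2 hm⟩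

theorem gap_sq_mul_riskH1' (i : Fin K) :
    gap Q i ^ 2 * riskH1' Q i =
      ∑ j ∈ Finset.univ.erase i, (gap Q i / (gap Q j + gap Q i)) ^ 2 := by
  rw [riskH1', Finset.mul_sum]
  refine Finset.sum_congr rfl fun j _ => ?_
  rw [div_pow, mul_one_div]

/-- The number of arms whose gap is at most that of arm `i`. -/
noncomputable def domCount (i : Fin K) : ℕ := (Finset.univ.filter fun j => gap Q j ≤ gap Q i).card

theorem domCount_pos (i : Fin K) : 0 < domCount Q i :=
  Finset.card_pos.2 ⟨i, by simp⟩

theorem domCount_le_nonbest {i : Fin K} (hi : i ∉ bestArms Q) :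
    (domCount Q i : ℝ) / 4 ≤ gap Q i ^ 2 * riskH1' Q i := by
  obtain ⟨m, hm⟩ := bestArms_nonempty Q i
  have hgi := gap_pos Q hi
  have hgm := (mem_bestArms_iff_gap Q).1 hm
  have hmi : m ≠ i := fun h => hi (h ▸ hm)
  set S := Finset.univ.filter fun j => gap Q j ≤ gap Q i with hS
  have hiS : i ∈ S := by simp [hS]
  have hmS : m ∈ S.erase i := by
    rw [Finset.mem_erase]; refine ⟨hmi, ?_⟩; simp [hS, hgm, gap_nonneg]
  rw [gap_sq_mul_riskH1']
  calc (domCount Q i : ℝ) / 4 ≤ 1 + ∑ j ∈ (S.erase i).erase m, (1 / 4 : ℝ) := by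
        rw [Finset.sum_const, nsmul_eq_mul, Finset.card_erase_of_mem hmS,
          Finset.card_erase_of_mem hiS]
        have : (domCount Q i : ℝ) ≤ ((S.card - 1 - 1 : ℕ) : ℝ) + 2 := by
          unfold domCount
          rw [← hS]
          norm_cast
          omega
        linarith
    _ ≤ (gap Q i / (gap Q m + gap Q i)) ^ 2 +
          ∑ j ∈ (S.erase i).erase m, (gap Q i / (gap Q j + gap Q i)) ^ 2 := by
        refine add_le_add ?_ (Finset.sum_le_sum fun j hj => ?_)
        · rw [hgm, zero_add, div_self hgi.ne', one_pow]
        · have hj' : gap Q j ≤ gap Q i := by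
            have := Finset.mem_of_mem_erase (Finset.mem_of_mem_erase hj)
            simpa [hS] using this
          have h0 := gap_nonneg Q j
          have : (1 / 2 : ℝ) ≤ gap Q i / (gap Q j + gap Q i) := by
            rw [le_div_iff₀ (by linarith)]; linarith
          nlinarith
    _ = ∑ j ∈ S.erase i, (gap Q i / (gap Q j + gap Q i)) ^ 2 :=
        Finset.add_sum_erase _ (fun j => (gap Q i / (gap Q j + gap Q i)) ^ 2) hmS
    _ ≤ _ := Finset.sum_le_sum_of_subset_of_nonneg
        (Finset.erase_subset_erase _ (Finset.subset_univ _)) fun _ _ _ => sq_nonneg _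

theorem nonbest_le {i : Fin K} (hi : i ∉ bestArms Q) :
    gap Q i ^ 2 * riskH1' Q i ≤ K := by
  have hgi := gap_pos Q hi
  rw [gap_sq_mul_riskH1']
  calc ∑ j ∈ Finset.univ.erase i, (gap Q i / (gap Q j + gap Q i)) ^ 2
      ≤ ∑ j ∈ Finset.univ.erase i, (1 : ℝ) := by
        refine Finset.sum_le_sum fun j _ => ?_
        have h0 := gap_nonneg Q j
        have h1 : gap Q i / (gap Q j + gap Q i) ≤ 1 := by
          rw [div_le_one (by linarith)]; linarith
        have h2 : 0 ≤ gap Q i / (gap Q j + gap Q i) := by positivity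
        nlinarith
    _ ≤ K := by
        rw [Finset.sum_const, nsmul_eq_mul, mul_one]
        exact_mod_cast (Finset.card_le_univ _).trans (by simp)

variable {Q}

theorem domCount_le_costD (hQ : bestArms Q ≠ Finset.univ) (i : Fin K) :
    (domCount Q i : ℝ) / 4 ≤ costD Q i := by
  unfold costD
  by_cases hi : i ∈ bestArms Q
  · rw [if_neg (not_not.2 hi), if_neg hQ]
    obtain ⟨j, hj⟩ : ∃ j, j ∉ bestArms Q := by
      by_contra! h; exact hQ (Finset.eq_univ_of_forall h)
    have : Nonempty {j : Fin K // j ∉ bestArms Q} := ⟨⟨j, hj⟩⟩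
    refine le_ciInf fun j => le_trans ?_ (domCount_le_nonbest Q j.2)
    have : domCount Q i ≤ domCount Q j := by
      refine Finset.card_le_card fun k hk => ?_
      simp only [Finset.mem_filter, Finset.mem_univ, true_and] at hk ⊢
      rw [(mem_bestArms_iff_gap Q).1 hi] at hk
      exact hk.trans (gap_nonneg Q _)
    have : (domCount Q i : ℝ) ≤ domCount Q j := by exact_mod_cast this
    linarith
  · rw [if_pos hi]
    exact domCount_le_nonbest Q hi

variable (Q)

theorem costD_le (i : Fin K) : costD Q i ≤ K := by
  have hK : (1 : ℝ) ≤ K := by exact_mod_cast i.pos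
  unfold costD
  by_cases hi : i ∈ bestArms Q
  · rw [if_neg (not_not.2 hi)]
    split_ifs with hQ
    · exact hK
    · obtain ⟨j, hj⟩ : ∃ j, j ∉ bestArms Q := by
        by_contra! h; exact hQ (Finset.eq_univ_of_forall h)
      exact (ciInf_le (Set.finite_range _).bddBelow (⟨j, hj⟩ : {j : Fin K // j ∉ bestArms Q})).trans
        (nonbest_le Q hj)
  · rw [if_pos hi]
    exact nonbest_le Q hi

theorem costD_of_tied (hQ : bestArms Q = Finset.univ) (i : Fin K) : costD Q i = 1 := by
  simp [costD, hQ]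

theorem costD_pos (i : Fin K) : 0 < costD Q i := by
  by_cases hQ : bestArms Q = Finset.univ
  · rw [costD_of_tied Q hQ]; exact one_pos
  · have h1 : (0 : ℝ) < domCount Q i := by exact_mod_cast domCount_pos Q i
    linarith [domCount_le_costD hQ i]

theorem sum_one_div_card_le {α : Type*} [DecidableEq α] (f : α → ℝ) (A : Finset α) :
    ∑ i ∈ A, 1 / ((A.filter fun j => f j ≤ f i).card : ℝ) ≤ (harmonic A.card : ℝ) := by
  induction A using Finset.induction_on_max_value f with
  | empty => simp
  | insert a s ha hmax ih =>
    rw [Finset.sum_insert ha, Finset.card_insert_of_notMem ha, harmonic_succ]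
    have h1 : (insert a s).filter (fun j => f j ≤ f a) = insert a s := by
      refine Finset.filter_true_of_mem fun j hj => ?_
      rcases Finset.mem_insert.1 hj with rfl | hj
      · exact le_rfl
      · exact hmax j hj
    rw [h1, Finset.card_insert_of_notMem ha, add_comm]
    push_cast
    refine add_le_add ((Finset.sum_le_sum fun i hi => ?_).trans ih) (by simp)
    refine one_div_le_one_div_of_le ?_ ?_
    · have : 0 < (s.filter fun j => f j ≤ f i).card :=
        Finset.card_pos.2 ⟨i, by simp [hi]⟩
      exact_mod_cast this
    · exact_mod_cast Finset.card_le_card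
        (Finset.filter_subset_filter _ (Finset.subset_insert a s))

variable {Q}

theorem sum_one_div_costD_le (hQ : bestArms Q ≠ Finset.univ) (A : Finset (Fin K)) :
    ∑ i ∈ A, 1 / costD Q i ≤ 4 * (1 + Real.log A.card) := by
  calc ∑ i ∈ A, 1 / costD Q i
      ≤ ∑ i ∈ A, 4 * (1 / ((A.filter fun j => gap Q j ≤ gap Q i).card : ℝ)) := by
        refine Finset.sum_le_sum fun i hi => ?_
        have h0 : (0 : ℝ) < (A.filter fun j => gap Q j ≤ gap Q i).card := by
          exact_mod_cast Finset.card_pos.2 ⟨i, by simp [hi]⟩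
        have h1 : ((A.filter fun j => gap Q j ≤ gap Q i).card : ℝ) ≤ domCount Q i := by
          exact_mod_cast Finset.card_le_card
            (Finset.filter_subset_filter _ (Finset.subset_univ A))
        have h2 := domCount_le_costD hQ i
        rw [mul_one_div, div_le_div_iff₀ (costD_pos Q i) h0]
        linarith
    _ ≤ 4 * (harmonic A.card : ℝ) := by
        rw [← Finset.mul_sum]
        exact mul_le_mul_of_nonneg_left (sum_one_div_card_le (gap Q) A) (by norm_num)
    _ ≤ _ := mul_le_mul_of_nonneg_left (harmonic_le_one_add_log _) (by norm_num)

theorem normZ_le_log (hQ : bestArms Q ≠ Finset.univ) : normZ Q ≤ 4 * (1 + Real.log K) := by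
  simpa [normZ] using sum_one_div_costD_le hQ Finset.univ

variable (Q)

theorem normZ_pos (i : Fin K) : 0 < normZ Q :=
  Finset.sum_pos (fun j _ => one_div_pos.2 (costD_pos Q j)) ⟨i, Finset.mem_univ i⟩

/-- If a group `G` of arms has means within `1/4` of `0` and the largest mean is at least `1/2`,
the gaps of `G` are comparable, so that the arms of `G` contribute little to `Z`. -/
theorem sum_one_div_costD_flat_le {G : Finset (Fin K)} (hG : ∀ i ∈ G, |Q i| < 1 / 4)
    {m : Fin K} (hm : 1 / 2 ≤ Q m) : ∑ i ∈ G, 1 / costD Q i ≤ 16 := by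
  have hM : 1 / 2 ≤ ⨆ j, Q j := hm.trans (le_iSup_arm Q m)
  obtain ⟨b, hb⟩ := bestArms_nonempty Q m
  have hgb := (mem_bestArms_iff_gap Q).1 hb
  have hlow : ∀ i ∈ G, (⨆ j, Q j) - 1 / 4 < gap Q i ∧ gap Q i < (⨆ j, Q j) + 1 / 4 := by
    intro i hi
    have := abs_lt.1 (hG i hi)
    unfold gap
    constructor <;> linarith
  have hbG : b ∉ G := fun h => by have := (hlow b h).1; linarith
  have key : ∀ i ∈ G, (G.card : ℝ) / 16 ≤ costD Q i := by
    intro i hi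
    have hgi : 0 < gap Q i := by have := (hlow i hi).1; linarith
    have hib : i ∉ bestArms Q := fun h => by
      rw [mem_bestArms_iff_gap] at h; linarith
    have hbi : b ≠ i := fun h => hib (h ▸ hb)
    rw [costD, if_pos hib, gap_sq_mul_riskH1']
    have hb' : b ∉ G.erase i := fun h => hbG (Finset.mem_of_mem_erase h)
    calc (G.card : ℝ) / 16 ≤ 1 + ∑ j ∈ G.erase i, (1 / 16 : ℝ) := by
          rw [Finset.sum_const, nsmul_eq_mul]
          have : (G.card : ℝ) = (G.erase i).card + 1 := by
            exact_mod_cast (Finset.card_erase_add_one hi).symm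
          linarith
      _ ≤ (gap Q i / (gap Q b + gap Q i)) ^ 2 +
          ∑ j ∈ G.erase i, (gap Q i / (gap Q j + gap Q i)) ^ 2 := by
          refine add_le_add ?_ (Finset.sum_le_sum fun j hj => ?_)
          · rw [hgb, zero_add, div_self hgi.ne', one_pow]
          · have h1 := hlow i hi
            have h2 := hlow j (Finset.mem_of_mem_erase hj)
            have : (1 / 4 : ℝ) ≤ gap Q i / (gap Q j + gap Q i) := by
              rw [le_div_iff₀ (by linarith)]; linarith
            nlinarith
      _ = ∑ j ∈ insert b (G.erase i), (gap Q i / (gap Q j + gap Q i)) ^ 2 := by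
          rw [Finset.sum_insert hb']
      _ ≤ _ := by
          refine Finset.sum_le_sum_of_subset_of_nonneg ?_ fun _ _ _ => sq_nonneg _
          intro j hj
          rcases Finset.mem_insert.1 hj with rfl | hj
          · simp [hbi]
          · simp [Finset.ne_of_mem_erase hj]
  rcases G.eq_empty_or_nonempty with rfl | hne
  · simp
  have hc : (0 : ℝ) < G.card := by exact_mod_cast hne.card_pos
  calc ∑ i ∈ G, 1 / costD Q i ≤ ∑ i ∈ G, 16 / (G.card : ℝ) := by
        refine Finset.sum_le_sum fun i hi => ?_
        have := key i hi
        rw [div_le_div_iff₀ (costD_pos Q i) hc]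
        linarith
    _ = 16 := by
        rw [Finset.sum_const, nsmul_eq_mul]
        field_simp

end costs

/-! ## The instance -/

section logInstance

variable {K : ℕ}

theorem pos_of_log (hK : 100 ≤ Real.log K) : 0 < K := by
  rcases Nat.eq_zero_or_pos K with rfl | h
  · norm_num at hK
  · exact h

theorem log_mul_le (hK : 100 ≤ Real.log K) : 50 * Real.log K ≤ K := by
  have h1 := Real.quadratic_le_exp_of_nonneg (show 0 ≤ Real.log K by linarith)
  rw [Real.exp_log (by exact_mod_cast pos_of_log hK)] at h1
  nlinarith

theorem floor_log_le (hK : 100 ≤ Real.log K) : (⌊Real.log K⌋₊ : ℝ) ≤ Real.log K :=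
  Nat.floor_le (by linarith)

theorem le_floor_log (hK : 100 ≤ Real.log K) : Real.log K / 2 ≤ (⌊Real.log K⌋₊ : ℝ) := by
  have := Nat.lt_floor_add_one (Real.log K)
  linarith

theorem floor_log_le_self (hK : 100 ≤ Real.log K) : ⌊Real.log K⌋₊ ≤ K := by
  have h1 := floor_log_le hK
  have h2 := log_mul_le hK
  have : (⌊Real.log K⌋₊ : ℝ) ≤ K := by linarith
  exact_mod_cast this

theorem one_le_log_log (hK : 100 ≤ Real.log K) : 1 ≤ Real.log (Real.log K) := by
  rw [Real.le_log_iff_exp_le (by linarith)]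
  have := Real.exp_one_lt_d9
  linarith

theorem card_top (hK : 100 ≤ Real.log K) :
    (Finset.univ.filter fun i : Fin K => i.val < ⌊Real.log K⌋₊).card = ⌊Real.log K⌋₊ := by
  rw [Fin.card_filter_val_lt, min_eq_right (floor_log_le_self hK)]

theorem logInstance_zero (hK : 0 < K) : logInstance K ⟨0, hK⟩ = 2 := by
  simp [logInstance]

theorem logInstance_le_one {i : Fin K} (hi : i.val ≠ 0) : logInstance K i ≤ 1 := by
  rw [logInstance, if_neg hi]
  split_ifs <;> norm_num

theorem logInstance_nonneg (i : Fin K) : 0 ≤ logInstance K i := by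
  unfold logInstance
  split_ifs <;> norm_num

theorem logInstance_top {i : Fin K} (hi : i.val < ⌊Real.log K⌋₊) : 1 ≤ logInstance K i := by
  unfold logInstance
  split_ifs <;> norm_num

theorem logInstance_bottom (hK : 100 ≤ Real.log K) {i : Fin K} (hi : ⌊Real.log K⌋₊ ≤ i.val) :
    logInstance K i = 0 := by
  have h := le_floor_log hK
  have h0 : 0 < ⌊Real.log K⌋₊ := by
    have : (0 : ℝ) < ⌊Real.log K⌋₊ := by linarith
    exact_mod_cast this
  unfold logInstance
  rw [if_neg (by omega), if_neg (by omega)]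

theorem bestArms_logInstance (hK : 0 < K) : bestArms (logInstance K) = {⟨0, hK⟩} := by
  ext i
  rw [mem_bestArms, Finset.mem_singleton]
  constructor
  · intro h
    by_contra hi
    have h1 := h ⟨0, hK⟩
    have h2 := logInstance_le_one (i := i) fun h => hi (Fin.ext h)
    rw [logInstance_zero] at h1
    linarith
  · rintro rfl j
    rw [logInstance_zero]
    by_cases hj : j.val = 0
    · have : j = ⟨0, hK⟩ := Fin.ext hj
      rw [this, logInstance_zero]
    · linarith [logInstance_le_one hj]

theorem gap_logInstance (hK : 0 < K) (i : Fin K) :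
    gap (logInstance K) i = 2 - logInstance K i := by
  have h : (⨆ j, logInstance K j) = 2 := by
    have h1 : (⟨0, hK⟩ : Fin K) ∈ bestArms (logInstance K) := by
      rw [bestArms_logInstance hK]; simp
    have h2 := (mem_bestArms_iff_gap _).1 h1
    rw [gap, logInstance_zero] at h2
    linarith
  rw [gap, h]

theorem le_riskH1_logInstance (hK : 100 ≤ Real.log K) :
    (K : ℝ) / 5 ≤ riskH1 (logInstance K) := by
  have hK0 := pos_of_log hK
  have h1 : ((bestArms (logInstance K))ᶜ.card : ℝ) = K - 1 := by
    rw [bestArms_logInstance hK0, Finset.card_compl, Finset.card_singleton, Fintype.card_fin,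
      Nat.cast_sub hK0, Nat.cast_one]
  have h2 := log_mul_le hK
  calc (K : ℝ) / 5 ≤ ∑ i ∈ (bestArms (logInstance K))ᶜ, (1 / 4 : ℝ) := by
        rw [Finset.sum_const, nsmul_eq_mul, h1]; linarith
    _ ≤ _ := Finset.sum_le_sum fun i hi => by
        have h3 := gap_pos _ (Finset.mem_compl.1 hi)
        have h4 : gap (logInstance K) i ≤ 2 := by
          rw [gap_logInstance hK0]; linarith [logInstance_nonneg i]
        refine one_div_le_one_div_of_le (by positivity) ?_
        nlinarith

theorem riskH1_logInstance_le (hK : 100 ≤ Real.log K) :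
    riskH1 (logInstance K) ≤ (K : ℝ) / 2 := by
  have hK0 := pos_of_log hK
  have h2 := log_mul_le hK
  have h5 := floor_log_le hK
  calc riskH1 (logInstance K)
      ≤ ∑ i ∈ (bestArms (logInstance K))ᶜ,
          ((1 / 4 : ℝ) + if i.val < ⌊Real.log K⌋₊ then 1 else 0) := by
        refine Finset.sum_le_sum fun i hi => ?_
        have h0 : i.val ≠ 0 := fun h => by
          rw [bestArms_logInstance hK0, Finset.mem_compl, Finset.mem_singleton] at hi
          exact hi (Fin.ext h)
        rw [gap_logInstance hK0]
        split_ifs with hiL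
        · have h6 := logInstance_le_one h0
          have : 1 / (2 - logInstance K i) ^ 2 ≤ 1 := by
            rw [div_le_one (by nlinarith)]; nlinarith
          linarith
        · rw [logInstance_bottom hK (not_lt.1 hiL)]; norm_num
    _ ≤ ∑ i : Fin K, ((1 / 4 : ℝ) + if i.val < ⌊Real.log K⌋₊ then 1 else 0) := by
        refine Finset.sum_le_sum_of_subset_of_nonneg (Finset.subset_univ _) fun i _ _ => ?_
        split_ifs <;> norm_num
    _ = K / 4 + ⌊Real.log K⌋₊ := by
        rw [Finset.sum_add_distrib, Finset.sum_boole, card_top hK]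
        simp [div_eq_mul_inv]
    _ ≤ _ := by linarith

/-- The bottom arms of the instance whose means in `Q` are not close to `0`. -/
noncomputable def deviatingArms (Q : Fin K → ℝ) : Finset (Fin K) :=
  Finset.univ.filter fun i => ⌊Real.log K⌋₊ ≤ i.val ∧ 1 / 4 ≤ |Q i|

theorem normZ_le_log_log (hK : 100 ≤ Real.log K) {Q : Fin K → ℝ}
    (hQ : bestArms Q ≠ Finset.univ) {m : Fin K} (hm : 1 / 2 ≤ Q m)
    (hd : ((deviatingArms Q).card : ℝ) ≤ Real.log K) :
    normZ Q ≤ 28 * Real.log (Real.log K) := by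
  have hl := one_le_log_log hK
  set G := Finset.univ.filter fun i : Fin K => ⌊Real.log K⌋₊ ≤ i.val ∧ |Q i| < 1 / 4 with hG
  have hc : (Gᶜ.card : ℝ) ≤ 2 * Real.log K := by
    have h1 : Gᶜ ⊆ (Finset.univ.filter fun i : Fin K => i.val < ⌊Real.log K⌋₊) ∪
        deviatingArms Q := by
      intro i hi
      simp only [hG, deviatingArms, Finset.mem_compl, Finset.mem_union, Finset.mem_filter,
        Finset.mem_univ, true_and, not_and, not_lt] at hi ⊢
      by_cases h : i.val < ⌊Real.log K⌋₊
      · exact Or.inl h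
      · exact Or.inr ⟨not_lt.1 h, hi (not_lt.1 h)⟩
    have h2 := (Finset.card_le_card h1).trans (Finset.card_union_le _ _)
    rw [card_top hK] at h2
    have h3 : (Gᶜ.card : ℝ) ≤ ⌊Real.log K⌋₊ + (deviatingArms Q).card := by exact_mod_cast h2
    linarith [floor_log_le hK]
  have hlog : Real.log Gᶜ.card ≤ 2 * Real.log (Real.log K) := by
    rcases Nat.eq_zero_or_pos Gᶜ.card with h | h
    · rw [h]; simp; linarith
    · calc Real.log Gᶜ.card ≤ Real.log (2 * Real.log K) :=
            Real.log_le_log (by exact_mod_cast h) hc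
        _ = Real.log 2 + Real.log (Real.log K) :=
            Real.log_mul (by norm_num) (by linarith)
        _ ≤ _ := by linarith [Real.log_two_lt_d9]
  have h1 : ∑ i ∈ G, 1 / costD Q i ≤ 16 :=
    sum_one_div_costD_flat_le Q (fun i hi => by simp [hG] at hi; simpa using hi.2) hm
  have h2 := sum_one_div_costD_le hQ Gᶜ
  rw [normZ, ← Finset.sum_add_sum_compl G]
  linarith

theorem normZ_le_five_log (hK : 100 ≤ Real.log K) {Q : Fin K → ℝ}
    (hQ : bestArms Q ≠ Finset.univ) : normZ Q ≤ 5 * Real.log K := by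
  linarith [normZ_le_log hQ]

theorem Misidentified.ne_univ (hK : 0 < K) {Q : Fin K → ℝ}
    (h : Misidentified (logInstance K) Q) : bestArms Q ≠ Finset.univ := by
  intro hQ
  refine h ⟨0, hK⟩ ?_ (by rw [hQ]; simp)
  rw [bestArms_logInstance hK]; simp

theorem Misidentified.exists_ge (hK : 0 < K) {Q : Fin K → ℝ}
    (h : Misidentified (logInstance K) Q) : ∃ j : Fin K, j.val ≠ 0 ∧ Q ⟨0, hK⟩ ≤ Q j := by
  obtain ⟨j, hj⟩ := bestArms_nonempty Q ⟨0, hK⟩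
  refine ⟨j, fun hj0 => ?_, (mem_bestArms Q).1 hj _⟩
  refine h ⟨0, hK⟩ (by rw [bestArms_logInstance hK]; simp) ?_
  have : j = ⟨0, hK⟩ := Fin.ext hj0
  rwa [← this]

theorem card_mul_le_sum (P Q : Fin K → ℝ) (A : Finset (Fin K)) {a : ℝ}
    (hA : ∀ i ∈ A, a ≤ (Q i - P i) ^ 2) :
    A.card * (a / K) ≤ ∑ i, (Q i - P i) ^ 2 / costD Q i := by
  calc A.card * (a / K) = ∑ i ∈ A, a / K := by rw [Finset.sum_const, nsmul_eq_mul]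
    _ ≤ ∑ i ∈ A, (Q i - P i) ^ 2 / costD Q i := by
        refine Finset.sum_le_sum fun i hi => ?_
        exact div_le_div₀ (sq_nonneg _) (hA i hi) (costD_pos Q i) (costD_le Q i)
    _ ≤ _ := Finset.sum_le_sum_of_subset_of_nonneg (Finset.subset_univ _)
        fun i _ _ => div_nonneg (sq_nonneg _) (costD_pos Q i).le

theorem le_stblS_div_normZ (hK : 100 ≤ Real.log K) {Q : Fin K → ℝ}
    (h : Misidentified (logInstance K) Q) :
    1 / 800 / Real.log (Real.log K) ≤ stblS Q (logInstance K) / normZ Q := by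
  have hK0 := pos_of_log hK
  have hKr : (0 : ℝ) < K := by exact_mod_cast hK0
  have hl := one_le_log_log hK
  have hQ := h.ne_univ hK0
  have hZ := normZ_pos Q ⟨0, hK0⟩
  have hZ5 := normZ_le_five_log hK hQ
  have hH := le_riskH1_logInstance hK
  have hS : ∀ A : Finset (Fin K), ∀ a : ℝ, 0 ≤ a → (∀ i ∈ A, a ≤ (Q i - logInstance K i) ^ 2) →
      A.card * a / 5 ≤ stblS Q (logInstance K) := by
    intro A a ha hA
    have h1 := card_mul_le_sum (logInstance K) Q A hA
    calc (A.card : ℝ) * a / 5 = A.card * (a / K) * (K / 5) := by field_simp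
      _ ≤ _ := mul_le_mul h1 hH (by positivity) (le_trans (by positivity) h1)
  rw [div_le_div_iff₀ (by linarith) hZ]
  by_cases hM : ∃ m, 1 / 2 ≤ Q m
  · obtain ⟨m, hm⟩ := hM
    by_cases hd : ((deviatingArms Q).card : ℝ) ≤ Real.log K
    · have hZl := normZ_le_log_log hK hQ hm hd
      obtain ⟨j, hj0, hj⟩ := h.exists_ge hK0
      have h0 := logInstance_zero hK0
      have h1 := logInstance_le_one hj0
      have hS1 : 1 / 20 ≤ stblS Q (logInstance K) := by
        by_cases h2 : Q ⟨0, hK0⟩ ≤ 3 / 2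
        · have := hS {⟨0, hK0⟩} (1 / 4) (by norm_num) (by
            simp only [Finset.mem_singleton, forall_eq]; rw [h0]; nlinarith)
          norm_num at this ⊢; linarith
        · have := hS {j} (1 / 4) (by norm_num) (by
            simp only [Finset.mem_singleton, forall_eq]; nlinarith)
          norm_num at this ⊢; linarith
      nlinarith
    · have hS1 := hS (deviatingArms Q) (1 / 16) (by norm_num) fun i hi => by
        simp only [deviatingArms, Finset.mem_filter, Finset.mem_univ, true_and] at hi
        rw [logInstance_bottom hK hi.1, sub_zero, ← sq_abs]
        nlinarith [hi.2]
      nlinarith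
  · push Not at hM
    have hS1 := hS (Finset.univ.filter fun i : Fin K => i.val < ⌊Real.log K⌋₊) (1 / 4)
      (by norm_num) fun i hi => by
        simp only [Finset.mem_filter, Finset.mem_univ, true_and] at hi
        have h1 := logInstance_top hi
        have h2 := hM i
        nlinarith
    rw [card_top hK] at hS1
    have := le_floor_log hK
    nlinarith

theorem le_guaranteedRate (hK : 100 ≤ Real.log K) :
    1 / 800 / (K * Real.log (Real.log K)) ≤ guaranteedRate allocStar (logInstance K) := by
  have hK0 := pos_of_log hK
  have hKr : (0 : ℝ) < K := by exact_mod_cast hK0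
  have hl := one_le_log_log hK
  have hK1 : 1 < K := by
    have : (1 : ℝ) < K := by linarith [log_mul_le hK]
    exact_mod_cast this
  have hne : Nonempty {Q : Fin K → ℝ // Misidentified (logInstance K) Q} := by
    refine ⟨⟨fun i => if i.val = 0 then 0 else 1, fun i hi => ?_⟩⟩
    rw [bestArms_logInstance hK0, Finset.mem_singleton] at hi
    rw [mem_bestArms, hi]
    intro h
    have := h ⟨1, hK1⟩
    norm_num at this
  refine le_ciInf fun ⟨Q, hQ⟩ => ?_
  have h1 := le_stblS_div_normZ hK hQ
  have hH := riskH1_logInstance_le hK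
  have hH0 : 0 < riskH1 (logInstance K) := by
    have := le_riskH1_logInstance hK
    have : 0 < (K : ℝ) / 5 := by positivity
    linarith
  have hZ := normZ_pos Q ⟨0, hK0⟩
  have h2 : ∑ i, allocStar Q i * (Q i - logInstance K i) ^ 2 / 2 =
      stblS Q (logInstance K) / normZ Q / (2 * riskH1 (logInstance K)) := by
    rw [stblS, div_div, mul_comm (∑ i, _) (riskH1 _),
      show normZ Q * (2 * riskH1 (logInstance K)) = riskH1 (logInstance K) * (2 * normZ Q) by ring,
      mul_div_mul_left _ _ hH0.ne', Finset.sum_div]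
    refine Finset.sum_congr rfl fun i _ => ?_
    have := costD_pos Q i
    rw [allocStar]
    field_simp
  rw [h2, le_div_iff₀ (by positivity)]
  refine le_trans ?_ h1
  calc 1 / 800 / (K * Real.log (Real.log K)) * (2 * riskH1 (logInstance K))
      ≤ 1 / 800 / (K * Real.log (Real.log K)) * K := by gcongr; linarith
    _ = _ := by field_simp

theorem le_allocStar {Q : Fin K → ℝ} {z : ℝ} (hz : 1 ≤ z)
    (h : bestArms Q ≠ Finset.univ → normZ Q ≤ z) (i : Fin K) :
    1 / (K * z) ≤ allocStar Q i := by
  have hK : (0 : ℝ) < K := by exact_mod_cast i.pos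
  have hZ := normZ_pos Q i
  have hD := costD_pos Q i
  refine one_div_le_one_div_of_le (by positivity) ?_
  by_cases hQ : bestArms Q = Finset.univ
  · have h1 : normZ Q = K := by simp [normZ, costD_of_tied Q hQ]
    rw [h1, costD_of_tied Q hQ]
    nlinarith
  · exact mul_le_mul (costD_le Q i) (h hQ) hZ.le hK.le

theorem sum_allocStar (Q : Fin K → ℝ) (i : Fin K) : ∑ j, allocStar Q j = 1 := by
  have hZ := normZ_pos Q i
  have : ∀ j, allocStar Q j = 1 / costD Q j / normZ Q := fun j => by
    rw [allocStar, div_div]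
  simp_rw [this]
  rw [← Finset.sum_div, ← normZ, div_self hZ.ne']

theorem allocStar_pos (Q : Fin K → ℝ) (i : Fin K) : 0 < allocStar Q i :=
  one_div_pos.2 (mul_pos (costD_pos Q i) (normZ_pos Q i))

end logInstance

/-! ## The complexity `H₃` of the instance -/

section riskH3

variable {K : ℕ}

/-- The number of bottom arms of the instance. -/
noncomputable def bottomCount (K : ℕ) : ℝ := (K : ℝ) - ⌊Real.log K⌋₊

/-- The closed form of `H₃` on the instance. -/
noncomputable def instanceH3 (K : ℕ) : ℝ := K * (bottomCount K + 1) / (2 * bottomCount K)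

theorem bottomCount_gt (hK : 100 ≤ Real.log K) : 4 * Real.log K < bottomCount K := by
  have h1 := floor_log_le hK
  have h2 := log_mul_le hK
  unfold bottomCount
  linarith

theorem instanceH3_ge (hK : 100 ≤ Real.log K) : (K : ℝ) / 2 ≤ instanceH3 K := by
  have hM := bottomCount_gt hK
  have hM0 : 0 < bottomCount K := by linarith
  rw [instanceH3, div_le_div_iff₀ (by norm_num) (by positivity)]
  nlinarith [Nat.cast_nonneg (α := ℝ) K]

theorem instanceH3_pos (hK : 100 ≤ Real.log K) : 0 < instanceH3 K := by
  have h0 : (0 : ℝ) < K := by exact_mod_cast pos_of_log hK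
  linarith [instanceH3_ge hK]

theorem one_lt_floor_log (hK : 100 ≤ Real.log K) : 1 < ⌊Real.log K⌋₊ := by
  have := le_floor_log hK
  have : (1 : ℝ) < ⌊Real.log K⌋₊ := by linarith
  exact_mod_cast this

/-- The rate at which arm `1` and `m` bottom arms are confused, compared with `H₃`. -/
theorem div_instanceH3_le (hK : 100 ≤ Real.log K) {m j : ℝ} (hm : 1 ≤ m)
    (hmM : m ≤ bottomCount K) (hj : j ≤ m + ⌊Real.log K⌋₊) :
    j / instanceH3 K ≤ 2 * m / (m + 1) := by
  have h0 : (0 : ℝ) < K := by exact_mod_cast pos_of_log hK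
  have hM := bottomCount_gt hK
  have hM0 : 0 < bottomCount K := by linarith
  have hKM : (K : ℝ) = bottomCount K + ⌊Real.log K⌋₊ := by unfold bottomCount; ring
  have hL := floor_log_le hK
  rw [div_le_div_iff₀ (instanceH3_pos hK) (by linarith), instanceH3, mul_div_assoc',
    le_div_iff₀ (by positivity), hKM]
  set M := bottomCount K
  set l : ℝ := (⌊Real.log K⌋₊ : ℝ)
  have h1 : 0 ≤ (M - m) * (m * M - l) := by
    refine mul_nonneg (by linarith) ?_
    nlinarith
  have h2 : j * (m + 1) * (2 * M) ≤ (m + l) * (m + 1) * (2 * M) := by gcongr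
  nlinarith

theorem div_instanceH3_le_half (hK : 100 ≤ Real.log K) {j : ℝ} (hj : j ≤ ⌊Real.log K⌋₊) :
    j / instanceH3 K ≤ 1 / 8 := by
  have h1 := floor_log_le hK
  have h2 := log_mul_le hK
  have h3 := instanceH3_ge hK
  rw [div_le_iff₀ (instanceH3_pos hK)]
  linarith

theorem sum_three_groups (hK : 100 ≤ Real.log K) (a b c : ℝ) :
    ∑ i : Fin K, (if i.val = 0 then a else if i.val < ⌊Real.log K⌋₊ then b else c) =
      a + (⌊Real.log K⌋₊ - 1) * b + bottomCount K * c := by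
  have hL := one_lt_floor_log hK
  have h0 := pos_of_log hK
  have h1 : ∀ i : Fin K, (if i.val = 0 then a else if i.val < ⌊Real.log K⌋₊ then b else c) =
      c + (if i.val < ⌊Real.log K⌋₊ then b - c else 0) +
        (if i = ⟨0, h0⟩ then a - b else 0) := by
    intro i
    by_cases hi : i.val = 0
    · have : i = ⟨0, h0⟩ := Fin.ext hi
      rw [if_pos hi, if_pos (by omega), if_pos this]; ring
    · have : i ≠ ⟨0, h0⟩ := fun h => hi (by rw [h])
      rw [if_neg hi, if_neg this]
      split_ifs <;> ring
  simp_rw [h1]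
  rw [Finset.sum_add_distrib, Finset.sum_add_distrib, Finset.sum_ite_eq' Finset.univ,
    ← Finset.sum_filter, Finset.sum_const, Finset.sum_const, card_top hK, Finset.card_univ,
    Fintype.card_fin, if_pos (Finset.mem_univ _)]
  simp only [nsmul_eq_mul, bottomCount]
  ring

theorem le_sum_modGap (hK : 100 ≤ Real.log K) {j : ℕ} (hj2 : 2 ≤ j) (hjK : j ≤ K) :
    2 * j / instanceH3 K ≤
      ∑ i ∈ Finset.univ.filter (fun i : Fin K => i.val < j),
        modGap (logInstance K) j i ^ 2 := by
  have h0 := pos_of_log hK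
  have hL := one_lt_floor_log hK
  set x := modMean (logInstance K) j with hx
  have hg0 : modGap (logInstance K) j ⟨0, h0⟩ = 2 - x := by
    rw [modGap, if_pos rfl, logInstance_zero]
  by_cases hjL : j ≤ ⌊Real.log K⌋₊
  · have h1 := div_instanceH3_le_half hK (j := j) (by exact_mod_cast hjL)
    have hP1 : logInstance K ⟨1, by omega⟩ = 1 := by
      rw [logInstance, if_neg (by simp), if_pos (by simpa using hL)]
    have hg1 : modGap (logInstance K) j ⟨1, by omega⟩ = max (x - 1) 0 := by
      rw [modGap, if_neg (by simp), hP1]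
    have hsub : ({⟨0, h0⟩, ⟨1, by omega⟩} : Finset (Fin K)) ⊆
        Finset.univ.filter (fun i : Fin K => i.val < j) := by
      intro i hi
      simp only [Finset.mem_insert, Finset.mem_singleton] at hi
      rcases hi with rfl | rfl <;> simp <;> omega
    refine le_trans ?_ (Finset.sum_le_sum_of_subset_of_nonneg hsub fun _ _ _ => sq_nonneg _)
    rw [Finset.sum_pair (by simp), hg0, hg1, mul_div_assoc]
    rcases le_total x 1 with h | h
    · nlinarith [sq_nonneg (max (x - 1) 0)]
    · rw [max_eq_left (by linarith)]
      nlinarith [sq_nonneg (2 * x - 3)]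
  · push Not at hjL
    set A := Finset.univ.filter (fun i : Fin K => ⌊Real.log K⌋₊ ≤ i.val ∧ i.val < j) with hA
    have hcard : (A.card : ℝ) = j - ⌊Real.log K⌋₊ := by
      have h1 : (Finset.univ.filter (fun i : Fin K => i.val < j)).card =
          A.card + (Finset.univ.filter (fun i : Fin K => i.val < ⌊Real.log K⌋₊)).card := by
        rw [← Finset.card_union_of_disjoint]
        · congr 1
          ext i
          simp only [hA, Finset.mem_union, Finset.mem_filter, Finset.mem_univ, true_and]
          omega
        · rw [Finset.disjoint_filter]
          intro i _ h
          omega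
      rw [card_top hK, Fin.card_filter_val_lt, min_eq_right hjK] at h1
      rw [h1]; push_cast; ring
    have hgA : ∀ i ∈ A, modGap (logInstance K) j i = max x 0 := by
      intro i hi
      simp only [hA, Finset.mem_filter, Finset.mem_univ, true_and] at hi
      rw [modGap, if_neg (by omega), logInstance_bottom hK hi.1, sub_zero]
    have h0A : (⟨0, h0⟩ : Fin K) ∉ A := by
      simp only [hA, Finset.mem_filter, Finset.mem_univ, true_and]; omega
    have hsub : insert ⟨0, h0⟩ A ⊆ Finset.univ.filter (fun i : Fin K => i.val < j) := by
      intro i hi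
      simp only [hA, Finset.mem_insert, Finset.mem_filter, Finset.mem_univ, true_and] at hi ⊢
      rcases hi with rfl | hi
      · simp; omega
      · exact hi.2
    refine le_trans ?_ (Finset.sum_le_sum_of_subset_of_nonneg hsub fun _ _ _ => sq_nonneg _)
    rw [Finset.sum_insert h0A, hg0, Finset.sum_congr rfl fun i hi => by rw [hgA i hi],
      Finset.sum_const, nsmul_eq_mul, hcard]
    have hm : (1 : ℝ) ≤ j - ⌊Real.log K⌋₊ := by
      have : (⌊Real.log K⌋₊ : ℝ) + 1 ≤ j := by exact_mod_cast hjL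
      linarith
    have hmM : (j : ℝ) - ⌊Real.log K⌋₊ ≤ bottomCount K := by
      unfold bottomCount
      have : (j : ℝ) ≤ K := by exact_mod_cast hjK
      linarith
    have h1 := div_instanceH3_le hK hm hmM (j := j) (by linarith)
    set m : ℝ := (j : ℝ) - ⌊Real.log K⌋₊
    rw [mul_div_assoc]
    refine (mul_le_mul_of_nonneg_left h1 (by norm_num)).trans ?_
    rw [mul_div_assoc', div_le_iff₀ (by linarith)]
    rcases le_total x 0 with h | h
    · have h4 : 4 ≤ (2 - x) ^ 2 := by nlinarith
      rw [max_eq_right h]; nlinarith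
    · rw [max_eq_left h]
      nlinarith [sq_nonneg (2 - x - m * x)]

theorem topArms_logInstance (hK : 100 ≤ Real.log K) {x : ℝ} (hx0 : 0 ≤ x) (hx1 : x < 1) :
    x = (∑ i ∈ topArms (logInstance K) K x, logInstance K i) /
      (topArms (logInstance K) K x).card ↔ x = 2 / (bottomCount K + 1) := by
  have hmem : ∀ i : Fin K, i ∈ topArms (logInstance K) K x ↔
      (i.val = 0 ∨ ⌊Real.log K⌋₊ ≤ i.val) := by
    intro i
    simp only [topArms, Finset.mem_filter, Finset.mem_univ, true_and, i.isLt]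
    by_cases hi : i.val = 0
    · simp [hi]
    · by_cases hL : ⌊Real.log K⌋₊ ≤ i.val
      · simp [hL, logInstance_bottom hK hL, hx0]
      · have := logInstance_top (not_le.1 hL)
        simp only [hi, hL, or_self, iff_false, false_or, not_le]
        linarith
  have hind : ∀ (f : Fin K → ℝ) (a c : ℝ), (∀ i, i.val = 0 → f i = a) →
      (∀ i : Fin K, ⌊Real.log K⌋₊ ≤ i.val → f i = c) →
      ∑ i ∈ topArms (logInstance K) K x, f i = a + bottomCount K * c := by
    intro f a c ha hc
    have h := sum_three_groups hK a 0 c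
    rw [mul_zero, add_zero] at h
    rw [← h, ← Finset.sum_filter_add_sum_filter_not Finset.univ
      (fun i => i ∈ topArms (logInstance K) K x), Finset.filter_mem_eq_inter, Finset.univ_inter]
    rw [Finset.sum_eq_zero (s := Finset.univ.filter _), add_zero]
    · refine Finset.sum_congr rfl fun i hi => ?_
      have hL := one_lt_floor_log hK
      rcases (hmem i).1 hi with h | h
      · rw [ha i h, if_pos h]
      · rw [hc i h, if_neg (by omega), if_neg (by omega)]
    · intro i hi
      simp only [Finset.mem_filter, Finset.mem_univ, true_and, hmem, not_or, not_le] at hi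
      rw [if_neg hi.1, if_pos hi.2]
  have hsum := hind (logInstance K) 2 0 (fun i hi => by simp [logInstance, hi])
    (fun i hi => logInstance_bottom hK hi)
  have hcard := hind (fun _ => 1) 1 1 (fun _ _ => rfl) (fun _ _ => rfl)
  rw [Finset.sum_const, nsmul_eq_mul, mul_one] at hcard
  rw [hsum, hcard, mul_zero, add_zero, mul_one, add_comm (1 : ℝ)]

theorem modMean_logInstance (hK : 100 ≤ Real.log K) :
    modMean (logInstance K) K = 2 / (bottomCount K + 1) := by
  have h0 := pos_of_log hK
  have hKr : (0 : ℝ) < K := by exact_mod_cast h0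
  have hM := bottomCount_gt hK
  have hM0 : 0 < bottomCount K := by linarith
  have hex : ∃ x : ℝ, x = (∑ i ∈ topArms (logInstance K) K x, logInstance K i) /
      (topArms (logInstance K) K x).card :=
    ⟨2 / (bottomCount K + 1), (topArms_logInstance hK (by positivity)
      (by rw [div_lt_one (by linarith)]; linarith)).2 rfl⟩
  have hspec := Classical.epsilon_spec hex
  change modMean (logInstance K) K = _ at hspec
  rw [← modMean] at hspec
  set x := modMean (logInstance K) K
  have hx0 : 0 ≤ x := by
    rw [hspec]
    exact div_nonneg (Finset.sum_nonneg fun i _ => logInstance_nonneg i) (Nat.cast_nonneg _)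
  rcases lt_or_ge x 1 with hx1 | hx1
  · exact (topArms_logInstance hK hx0 hx1).1 hspec
  · exfalso
    have htop : topArms (logInstance K) K x = Finset.univ := by
      refine Finset.filter_true_of_mem fun i _ => ⟨i.isLt, ?_⟩
      by_cases hi : i.val = 0
      · exact Or.inl hi
      · exact Or.inr ((logInstance_le_one hi).trans hx1)
    have hs := sum_three_groups hK 2 1 0
    change ∑ i, logInstance K i = _ at hs
    rw [htop, hs, Finset.card_univ, Fintype.card_fin, eq_div_iff hKr.ne'] at hspec
    have h1 := floor_log_le hK
    have h2 := log_mul_le hK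
    nlinarith

theorem riskH3_logInstance (hK : 100 ≤ Real.log K) :
    riskH3 (logInstance K) = instanceH3 K := by
  have h0 := pos_of_log hK
  have hKr : (0 : ℝ) < K := by exact_mod_cast h0
  have hH := instanceH3_pos hK
  have hM := bottomCount_gt hK
  have hM0 : 0 < bottomCount K := by linarith
  have h2K : 2 ≤ K := (one_lt_floor_log hK).trans_le (floor_log_le_self hK)
  have hle : ∀ j : Set.Icc 2 K, 2 * (j.1 : ℝ) /
      ∑ i ∈ Finset.univ.filter (fun i : Fin K => i.val < j.1), modGap (logInstance K) j.1 i ^ 2 ≤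
        instanceH3 K := by
    intro j
    have hj := le_sum_modGap hK j.2.1 j.2.2
    have hj0 : (0 : ℝ) < j.1 := by exact_mod_cast (show 0 < j.1 by have := j.2.1; omega)
    rw [div_le_iff₀ (lt_of_lt_of_le (by positivity) hj)]
    rw [div_le_iff₀ hH] at hj
    linarith
  have hne : Nonempty (Set.Icc 2 K) := ⟨⟨K, h2K, le_rfl⟩⟩
  refine le_antisymm (ciSup_le hle) ?_
  refine le_ciSup_of_le ⟨instanceH3 K, ?_⟩ ⟨K, h2K, le_rfl⟩ ?_
  · rintro _ ⟨j, rfl⟩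
    exact hle j
  · have hx := modMean_logInstance hK
    have hx1 : 2 / (bottomCount K + 1) ≤ 1 := by rw [div_le_one (by linarith)]; linarith
    have hx0 : 0 ≤ 2 / (bottomCount K + 1) := by positivity
    have hs := sum_three_groups hK ((2 - 2 / (bottomCount K + 1)) ^ 2) 0
      ((2 / (bottomCount K + 1)) ^ 2)
    have hF : ∑ i ∈ Finset.univ.filter (fun i : Fin K => i.val < K),
        modGap (logInstance K) K i ^ 2 = 4 * bottomCount K / (bottomCount K + 1) := by
      rw [Finset.filter_true_of_mem fun i _ => i.isLt]
      transitivity (2 - 2 / (bottomCount K + 1)) ^ 2 + (⌊Real.log K⌋₊ - 1) * 0 +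
        bottomCount K * (2 / (bottomCount K + 1)) ^ 2
      · rw [← hs]
        refine Finset.sum_congr rfl fun i _ => ?_
        rw [modGap, hx]
        by_cases hi : i.val = 0
        · rw [if_pos hi, if_pos hi]
          simp [logInstance, hi]
        · rw [if_neg hi, if_neg hi]
          split_ifs with hL
          · have := logInstance_top hL
            rw [max_eq_right (by linarith)]; norm_num
          · rw [logInstance_bottom hK (not_lt.1 hL), sub_zero, max_eq_left hx0]
      · field_simp
        ring
    change instanceH3 K ≤ 2 * (K : ℝ) / _
    rw [hF, instanceH3]
    apply le_of_eq
    field_simp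
    ring

theorem le_logBar (hK : 100 ≤ Real.log K) : Real.log K / 2 ≤ logBar K := by
  have h0 := pos_of_log hK
  have hKr : (0 : ℝ) < K := by exact_mod_cast h0
  have h1 : Real.log K ≤ (harmonic K : ℝ) := by
    refine le_trans (Real.log_le_log hKr ?_) (log_add_one_le_harmonic K)
    push_cast; linarith
  have h2 : (harmonic K : ℝ) = logBar K + 1 / 2 := by
    rw [harmonic_eq_sum_Icc, ← Finset.add_sum_Ioc_eq_sum_Icc h0, logBar]
    push_cast
    have : Finset.Ioc 1 K = Finset.Icc 2 K := by ext i; simp; omega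
    rw [this]
    simp only [one_div]
    norm_num
    ring
  linarith

theorem logBar_pos (hK : 100 ≤ Real.log K) : 0 < logBar K := by
  linarith [le_logBar hK]

theorem srRate_pos (hK : 100 ≤ Real.log K) : 0 < srRate (logInstance K) := by
  rw [srRate, riskH3_logInstance hK]
  exact one_div_pos.2 (mul_pos (instanceH3_pos hK) (logBar_pos hK))

theorem srRate_le (hK : 100 ≤ Real.log K) :
    srRate (logInstance K) ≤ 4 / (K * Real.log K) := by
  have hKr : (0 : ℝ) < K := by exact_mod_cast pos_of_log hK
  have h1 := le_logBar hK
  have h2 := instanceH3_ge hK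
  rw [srRate, riskH3_logInstance hK, div_le_div_iff₀
    (mul_pos (instanceH3_pos hK) (logBar_pos hK)) (by positivity)]
  have h3 : (K : ℝ) / 2 * (Real.log K / 2) ≤ instanceH3 K * logBar K :=
    mul_le_mul h2 h1 (by linarith) (instanceH3_pos hK).le
  linarith

theorem mul_srRate_le (hK : 100 ≤ Real.log K) {c : ℝ} (hc : 0 ≤ c) :
    c * (Real.log K / Real.log (Real.log K)) * srRate (logInstance K) ≤
      4 * c / (K * Real.log (Real.log K)) := by
  have hKr : (0 : ℝ) < K := by exact_mod_cast pos_of_log hK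
  have hl := one_le_log_log hK
  have h1 := srRate_le hK
  calc _ ≤ c * (Real.log K / Real.log (Real.log K)) * (4 / (K * Real.log K)) := by gcongr
    _ = _ := by field_simp

end riskH3

/-! ## The law of the sums of rewards of a stage -/

section rowSum

variable {K : ℕ}

/-- The sum of the first `n` rewards of an arm within the first stage. -/
def rowSum (n : ℕ) (i : Fin K) (X : RewardTable K) : ℝ :=
  ∑ s ∈ Finset.range n, X (0, i, s)

theorem measurable_rowSum (n : ℕ) (i : Fin K) : Measurable (rowSum n i) := by
  unfold rowSum; fun_prop

theorem map_rowSum (P : Fin K → ℝ) (n : ℕ) (i : Fin K) :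
    (rewardLaw P).map (rowSum n i) = gaussianReal (n * P i) n := by
  induction n with
  | zero =>
    have : rowSum 0 i = fun _ : RewardTable K => (0 : ℝ) := by ext; simp [rowSum]
    rw [this, Measure.map_const]
    simp
  | succ n ih =>
    have hinj : Function.Injective (fun s : ℕ => ((0, i, s) : ℕ × Fin K × ℕ)) := by
      intro s t h; simpa using h
    have hind := (iIndepFun_reward P).precomp hinj
    have h1 := hind.indepFun_finsetSum_of_notMem (fun s => by fun_prop)
      (s := Finset.range n) (i := n) (by simp)
    have h2 : (∑ s ∈ Finset.range n, fun X : RewardTable K => X (0, i, s)) = rowSum n i := by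
      ext X; simp [rowSum]
    rw [h2] at h1
    have h3 := gaussianReal_add_gaussianReal_of_indepFun h1 ih (map_reward P (0, i, n))
    have h4 : (rowSum n i + fun X : RewardTable K => X (0, i, n)) = rowSum (n + 1) i := by
      ext X; simp [rowSum, Finset.sum_range_succ]
    rw [h4] at h3
    rw [h3]
    congr 1
    · push_cast; ring
    · push_cast; ring

theorem rewardLaw_rowSum_mem (P : Fin K → ℝ) (n : ℕ) (E : Fin K → Set ℝ)
    (hE : ∀ i, MeasurableSet (E i)) (A : Finset (Fin K)) :
    rewardLaw P {X | ∀ i ∈ A, rowSum n i X ∈ E i} =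
      ∏ i ∈ A, rewardLaw P {X | rowSum n i X ∈ E i} := by
  induction A using Finset.induction_on with
  | empty => simp
  | insert a A ha ih =>
    let S : Finset (ℕ × Fin K × ℕ) := {0} ×ˢ A ×ˢ Finset.range n
    let T : Finset (ℕ × Fin K × ℕ) := {0} ×ˢ {a} ×ˢ Finset.range n
    have hST : Disjoint S T := by
      rw [Finset.disjoint_left]
      rintro ⟨b, i, s⟩ h1 h2
      simp only [S, T, Finset.mem_product, Finset.mem_singleton] at h1 h2
      exact ha (h2.2.1 ▸ h1.2.1)
    have hind := (iIndepFun_reward P).indepFun_finset S T hST fun k => by fun_prop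
    let F : (S → ℝ) → A → ℝ := fun x i =>
      ∑ s : Finset.range n, x ⟨(0, i.1, s.1), by
        have := s.2
        simp only [S, Finset.mem_product, Finset.mem_singleton, Finset.coe_mem, true_and]⟩
    let G : (T → ℝ) → ℝ := fun x =>
      ∑ s : Finset.range n, x ⟨(0, a, s.1), by
        simp only [T, Finset.mem_product, Finset.mem_singleton, Finset.coe_mem, true_and]⟩
    have hF : Measurable F := by fun_prop
    have hG : Measurable G := by fun_prop
    have h := (hind.comp hF hG).measure_inter_preimage_eq_mul
      (Set.univ.pi fun i : A => E i.1) (E a)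
      (MeasurableSet.univ_pi fun i => hE _) (hE a)
    have hF' : ∀ X : RewardTable K, ∀ i : A, F (fun k : S => X k) i = rowSum n i.1 X := by
      intro X i
      exact Finset.sum_coe_sort (Finset.range n) (fun s => X (0, i.1, s))
    have hG' : ∀ X : RewardTable K, G (fun k : T => X k) = rowSum n a X := by
      intro X
      exact Finset.sum_coe_sort (Finset.range n) (fun s => X (0, a, s))
    have e1 : ((F ∘ fun (X : RewardTable K) (k : S) => X k) ⁻¹' Set.univ.pi fun i : A => E i.1) =
        {X | ∀ i ∈ A, rowSum n i X ∈ E i} := by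
      ext X
      simp only [Set.mem_preimage, Function.comp_apply, Set.mem_pi, Set.mem_univ, true_imp_iff,
        hF', Subtype.forall, Set.mem_ofPred_eq]
    have e2 : ((G ∘ fun (X : RewardTable K) (k : T) => X k) ⁻¹' E a) =
        {X | rowSum n a X ∈ E a} := by
      ext X
      simp only [Set.mem_preimage, Function.comp_apply, hG', Set.mem_ofPred_eq]
    rw [e1, e2, ih] at h
    rw [Finset.prod_insert ha, mul_comm, ← h]
    congr 1
    ext X
    simp only [Finset.forall_mem_insert, Set.mem_ofPred_eq, Set.mem_inter_iff]
    exact and_comm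

theorem gaussianReal_Icc_ge {μ u a : ℝ} {n : ℕ} (hn : 0 < n) (_ : 0 ≤ a)
    (h : ∀ y ∈ Set.Icc u (u + 1), |y - μ| ≤ n * a + 1) :
    ENNReal.ofReal (Real.exp (-(n * (a ^ 2 / 2) + a + 1 + Real.log (2 * Real.pi * n) / 2))) ≤
      gaussianReal μ n (Set.Icc u (u + 1)) := by
  have hn0 : (n : NNReal) ≠ 0 := by exact_mod_cast hn.ne'
  have hnr : (1 : ℝ) ≤ n := by exact_mod_cast hn
  rw [gaussianReal_apply _ hn0]
  have hpt : ∀ y ∈ Set.Icc u (u + 1),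
      ENNReal.ofReal (Real.exp (-(n * (a ^ 2 / 2) + a + 1 + Real.log (2 * Real.pi * n) / 2))) ≤
        gaussianPDF μ n y := by
    intro y hy
    refine ENNReal.ofReal_le_ofReal ?_
    have hpos : (0 : ℝ) < 2 * Real.pi * n := by have := Real.pi_pos; positivity
    have hsqrt : (√(2 * Real.pi * n))⁻¹ = Real.exp (-(Real.log (2 * Real.pi * n) / 2)) := by
      rw [Real.exp_neg, ← Real.log_sqrt hpos.le, Real.exp_log (Real.sqrt_pos.2 hpos)]
    rw [gaussianPDFReal]
    simp only [NNReal.coe_natCast]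
    rw [hsqrt, ← Real.exp_add]
    refine Real.exp_le_exp.2 ?_
    have h1 : (y - μ) ^ 2 ≤ (n * a + 1) ^ 2 := by
      rw [← sq_abs]
      exact pow_le_pow_left₀ (abs_nonneg _) (h y hy) 2
    have h2 : (y - μ) ^ 2 / (2 * n) ≤ n * (a ^ 2 / 2) + a + 1 := by
      rw [div_le_iff₀ (by linarith)]
      nlinarith
    rw [neg_div]
    linarith
  calc _ = ∫⁻ _ in Set.Icc u (u + 1), ENNReal.ofReal
        (Real.exp (-(n * (a ^ 2 / 2) + a + 1 + Real.log (2 * Real.pi * n) / 2))) := by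
        rw [setLIntegral_const, Real.volume_Icc]; simp
    _ ≤ _ := setLIntegral_mono' measurableSet_Icc hpt

theorem rowSum_ge_prob (P : Fin K → ℝ) {n : ℕ} (hn : 0 < n) (i : Fin K) (x : ℝ) :
    ENNReal.ofReal (Real.exp (-(n * ((max (x - P i) 0) ^ 2 / 2) + max (x - P i) 0 + 1 +
      Real.log (2 * Real.pi * n) / 2))) ≤ rewardLaw P {X | n * x ≤ rowSum n i X} := by
  have hnr : (0 : ℝ) < n := by exact_mod_cast hn
  have h1 : rewardLaw P {X | n * x ≤ rowSum n i X} = gaussianReal (n * P i) n (Set.Ici (n * x)) := by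
    rw [← map_rowSum P n i, Measure.map_apply (measurable_rowSum n i) measurableSet_Ici]
    rfl
  rw [h1]
  set a := max (x - P i) 0 with ha
  have ha0 : 0 ≤ a := le_max_right _ _
  have hax : x - P i ≤ a := le_max_left _ _
  refine (gaussianReal_Icc_ge (u := n * P i + n * a) hn ha0 fun y hy => ?_).trans
    (measure_mono fun y hy => ?_)
  · have : 0 ≤ n * a := by positivity
    rw [abs_le]; constructor <;> linarith [hy.1, hy.2]
  · have : (n : ℝ) * (x - P i) ≤ n * a := by gcongr
    rw [Set.mem_Ici]; nlinarith [hy.1]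

theorem rowSum_le_prob (P : Fin K → ℝ) {n : ℕ} (hn : 0 < n) (i : Fin K) {x : ℝ} (hx : x ≤ P i) :
    ENNReal.ofReal (Real.exp (-(n * ((P i - x) ^ 2 / 2) + (P i - x) + 1 +
      Real.log (2 * Real.pi * n) / 2))) ≤ rewardLaw P {X | rowSum n i X ≤ n * x} := by
  have hnr : (0 : ℝ) < n := by exact_mod_cast hn
  have h1 : rewardLaw P {X | rowSum n i X ≤ n * x} = gaussianReal (n * P i) n (Set.Iic (n * x)) := by
    rw [← map_rowSum P n i, Measure.map_apply (measurable_rowSum n i) measurableSet_Iic]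
    rfl
  rw [h1]
  refine (gaussianReal_Icc_ge (u := n * x - 1) hn (sub_nonneg.2 hx) fun y hy => ?_).trans
    (measure_mono fun y hy => ?_)
  · have : 0 ≤ n * (P i - x) := mul_nonneg hnr.le (sub_nonneg.2 hx)
    rw [abs_le]; constructor <;> nlinarith [hy.1, hy.2]
  · rw [Set.mem_Iic]; linarith [hy.2]

end rowSum

/-! ## Successive Rejects -/

section successiveRejects

variable {K : ℕ}

theorem card_srActive (X : RewardTable K) (T k : ℕ) : (srActive X T k).card = K - k := by
  induction k with
  | zero => simp [srActive]
  | succ k ih =>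
    rcases (srActive X T k).eq_empty_or_nonempty with h | h
    · rw [h, Finset.card_empty] at ih
      rw [srActive, h]
      simp only [Finset.filter_empty, Finset.card_empty]
      omega
    · obtain ⟨m, hm, hmin⟩ := Finset.exists_min_image (srActive X T k)
        (fun i => toLex (srMean X T (k + 1) i, i)) h
      have : srActive X T (k + 1) = (srActive X T k).erase m := by
        ext i
        simp only [srActive, Finset.mem_filter, Finset.mem_erase]
        constructor
        · rintro ⟨hi, j, hj, hji⟩
          refine ⟨?_, hi⟩
          rintro rfl
          have := hmin j hj
          rw [Prod.Lex.toLex_le_toLex] at this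
          simp only at this
          rcases hji with h1 | ⟨h1, h2⟩ <;> rcases this with h3 | ⟨h3, h4⟩
          · linarith
          · linarith
          · linarith
          · exact absurd h2 (not_lt.2 h4)
        · rintro ⟨hne, hi⟩
          refine ⟨hi, m, hm, ?_⟩
          have := hmin i hi
          rw [Prod.Lex.toLex_le_toLex] at this
          rcases this with h3 | ⟨h3, h4⟩
          · exact Or.inl h3
          · exact Or.inr ⟨h3, lt_of_le_of_ne h4 hne.symm⟩
      rw [this, Finset.card_erase_of_mem hm, ih]
      omega

theorem srActive_antitone (X : RewardTable K) (T : ℕ) : Antitone (srActive X T) :=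
  antitone_nat_of_succ_le fun k => by
    rw [srActive]; exact Finset.filter_subset _ _

theorem sum_srLength_sub (hK : 100 ≤ Real.log K) {T : ℕ} (hT : K ≤ T) {k : ℕ} (hk : k ≤ K) :
    ∑ a ∈ Finset.range k, (srLength K T (a + 1) - srLength K T a) = srLength K T k := by
  induction k with
  | zero => simp [srLength]
  | succ k ih =>
    rw [Finset.sum_range_succ, ih (by omega)]
    refine Nat.add_sub_of_le ?_
    rcases Nat.eq_zero_or_pos k with rfl | h
    · simp [srLength]
    · rw [srLength, srLength, if_neg h.ne', if_neg (by omega)]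
      refine Nat.ceil_mono ?_
      have h1 : (K : ℝ) ≤ T := by exact_mod_cast hT
      have h2 : (k : ℝ) + 1 ≤ K := by exact_mod_cast hk
      have h3 := logBar_pos hK
      refine div_le_div_of_nonneg_left (by linarith) (mul_pos h3 (by push_cast; linarith)) ?_
      refine mul_le_mul_of_nonneg_left ?_ h3.le
      push_cast; linarith

theorem srMean_le_prob (P : Fin K → ℝ) {T k : ℕ} (hn : 0 < srLength K T k)
    (hk : ∑ a ∈ Finset.range k, (srLength K T (a + 1) - srLength K T a) = srLength K T k)
    {z : Fin K} {S : Finset (Fin K)} (hz : z ∉ S) (hS : S.Nonempty) {p : ℝ}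
    (hp : ∀ i ∈ S, P i = p) (hpz : p ≤ P z) :
    rewardLaw P {X | ∀ i ∈ S, srMean X T k z ≤ srMean X T k i} ≤
      ENNReal.ofReal (Real.exp (-(srLength K T k *
        ((P z - p) ^ 2 * S.card / (2 * (S.card + 1)))))) := by
  set n := srLength K T k with hndef
  set m : ℝ := (S.card : ℝ) with hm
  have hnr : (0 : ℝ) < n := by exact_mod_cast hn
  have hm0 : 0 < m := by rw [hm]; exact_mod_cast hS.card_pos
  have hkr : ∑ a ∈ Finset.range k, ((srLength K T (a + 1) - srLength K T a : ℕ) : ℝ) = n := by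
    exact_mod_cast hk
  let c : Fin K → ℝ := fun i => (if i = z then -m else 0) + (if i ∈ S then 1 else 0)
  have hc : ∀ G : Fin K → ℝ, ∑ i, c i * G i = -m * G z + ∑ i ∈ S, G i := by
    intro G
    simp only [c, add_mul, ite_mul, zero_mul, one_mul]
    rw [Finset.sum_add_distrib, Finset.sum_ite_eq' Finset.univ, if_pos (Finset.mem_univ _),
      Finset.sum_ite_mem, Finset.univ_inter]
  have hc2 : ∑ i, c i ^ 2 = m ^ 2 + m := by
    have : ∀ i, c i ^ 2 = c i * c i := fun i => sq _
    simp_rw [this, hc]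
    have h1 : c z = -m := by simp [c, hz]
    have h2 : ∑ i ∈ S, c i = m := by
      rw [Finset.sum_congr rfl (g := fun _ => (1 : ℝ)), Finset.sum_const, nsmul_eq_mul, mul_one]
      intro i hi
      have : i ≠ z := fun h => hz (h ▸ hi)
      simp [c, hi, this]
    rw [h1, h2]; ring
  have ht0 : 0 ≤ n * (m * (P z - p)) := by
    have := sub_nonneg.2 hpz; positivity
  have key := reward_tail P k (fun a _ => srLength K T (a + 1) - srLength K T a) c ht0
  refine (measure_mono fun X hX => ?_).trans (key.trans (le_of_eq ?_))
  · have hswap : ∑ b ∈ Finset.range k, ∑ i, ∑ s ∈ Finset.range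
        (srLength K T (b + 1) - srLength K T b), c i * (X (b, i, s) - P i) =
        ∑ i, c i * (n * srMean X T k i - n * P i) := by
      rw [Finset.sum_comm]
      refine Finset.sum_congr rfl fun i _ => ?_
      simp_rw [← Finset.mul_sum]
      congr 1
      simp_rw [Finset.sum_sub_distrib, Finset.sum_const, Finset.card_range, nsmul_eq_mul]
      rw [← Finset.sum_mul, hkr, srMean, ← hndef, mul_div_cancel₀ _ hnr.ne']
    rw [Set.mem_ofPred_eq, hswap, hc]
    have h1 : ∑ i ∈ S, (n * srMean X T k z - n * p) ≤
        ∑ i ∈ S, (n * srMean X T k i - n * P i) := by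
      refine Finset.sum_le_sum fun i hi => ?_
      rw [hp i hi]
      have := mul_le_mul_of_nonneg_left (hX i hi) hnr.le
      linarith
    rw [Finset.sum_const, nsmul_eq_mul, ← hm] at h1
    nlinarith
  · congr 2
    simp_rw [← Finset.mul_sum]
    rw [hc2, ← Finset.sum_mul, hkr]
    field_simp

theorem le_srLength (T k : ℕ) :
    ((T : ℝ) - K) / (logBar K * ((K : ℝ) - k)) ≤ srLength K T (k + 1) := by
  rw [srLength, if_neg (by omega)]
  refine le_trans (le_of_eq ?_) (Nat.le_ceil _)
  push_cast
  congr 2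
  ring

theorem exists_rejected {X : RewardTable K} {T : ℕ} {z : Fin K}
    (h : ∃ i ∈ srActive X T (K - 1), i ≠ z) :
    ∃ k < K - 1, z ∈ srActive X T k ∧
      ∀ j ∈ srActive X T k, srMean X T (k + 1) z ≤ srMean X T (k + 1) j := by
  obtain ⟨i, hi, hiz⟩ := h
  by_contra! hcon
  have h1 : ∀ k ≤ K - 1, z ∈ srActive X T k := by
    intro k
    induction k with
    | zero => simp [srActive]
    | succ k ih =>
      intro hk
      obtain ⟨j, hj, hlt⟩ := hcon k (by omega) (ih (by omega))
      rw [srActive, Finset.mem_filter]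
      exact ⟨ih (by omega), j, hj, Or.inl hlt⟩
  have h2 : 1 < (srActive X T (K - 1)).card :=
    Finset.one_lt_card.2 ⟨i, hi, z, h1 _ le_rfl, hiz⟩
  rw [card_srActive] at h2
  omega

theorem srMean_le_prob_logInstance (hK : 100 ≤ Real.log K) {T k : ℕ} (hT : K < T) (hk : k < K - 1)
    {S : Finset (Fin K)} {p : ℝ} (hz : (⟨0, pos_of_log hK⟩ : Fin K) ∉ S) (hS : S.Nonempty)
    (hp : ∀ i ∈ S, logInstance K i = p) (hp2 : p ≤ 2)
    (hcost : ((K : ℝ) - k) / instanceH3 K ≤ (2 - p) ^ 2 * S.card / (2 * (S.card + 1))) :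
    rewardLaw (logInstance K) {X | ∀ i ∈ S,
      srMean X T (k + 1) ⟨0, pos_of_log hK⟩ ≤ srMean X T (k + 1) i} ≤
      ENNReal.ofReal (Real.exp (-((T - K) * srRate (logInstance K)))) := by
  have h0 := pos_of_log hK
  have hT' : (K : ℝ) < T := by exact_mod_cast hT
  have hk' : (k : ℝ) < K := by exact_mod_cast (show k < K by omega)
  have hH := instanceH3_pos hK
  have hlb := logBar_pos hK
  have hlen := le_srLength (K := K) T k
  have hpos : 0 < ((T : ℝ) - K) / (logBar K * ((K : ℝ) - k)) :=
    div_pos (by linarith) (mul_pos hlb (by linarith))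
  have hn : 0 < srLength K T (k + 1) := by exact_mod_cast hpos.trans_le hlen
  refine (srMean_le_prob _ hn (sum_srLength_sub hK hT.le (by omega)) hz hS hp
    (by rwa [logInstance_zero])).trans ?_
  refine ENNReal.ofReal_le_ofReal (Real.exp_le_exp.2 (neg_le_neg ?_))
  rw [logInstance_zero, srRate, riskH3_logInstance hK]
  calc ((T : ℝ) - K) * (1 / (instanceH3 K * logBar K))
      = ((T : ℝ) - K) / (logBar K * ((K : ℝ) - k)) * (((K : ℝ) - k) / instanceH3 K) := by
        have : (K : ℝ) - k ≠ 0 := by linarith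
        field_simp
    _ ≤ _ := mul_le_mul hlen hcost (div_nonneg (by linarith) hH.le) (Nat.cast_nonneg _)

theorem exists_rejection_witness (hK : 100 ≤ Real.log K) {X : RewardTable K} {T : ℕ}
    (h : ∃ i ∈ srActive X T (K - 1), i ∉ bestArms (logInstance K)) :
    ∃ k < K - 1, ∃ S : Finset (Fin K), ∃ p : ℝ, (⟨0, pos_of_log hK⟩ : Fin K) ∉ S ∧ S.Nonempty ∧
      (∀ i ∈ S, logInstance K i = p) ∧ p ≤ 2 ∧
      ((K : ℝ) - k) / instanceH3 K ≤ (2 - p) ^ 2 * S.card / (2 * (S.card + 1)) ∧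
      ∀ i ∈ S, srMean X T (k + 1) ⟨0, pos_of_log hK⟩ ≤ srMean X T (k + 1) i := by
  have h0 := pos_of_log hK
  have hL := one_lt_floor_log hK
  simp only [bestArms_logInstance h0, Finset.mem_singleton] at h
  obtain ⟨k, hk, hz, hle⟩ := exists_rejected h
  refine ⟨k, hk, ?_⟩
  set J := srActive X T k with hJ
  have hJc : J.card = K - k := card_srActive X T k
  have hJr : (J.card : ℝ) = (K : ℝ) - k := by
    rw [hJc, Nat.cast_sub (by omega)]
  have hsplit := Finset.card_filter_add_card_filter_not (s := J)
    (fun i => ⌊Real.log K⌋₊ ≤ i.val)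
  have htop : (J.filter fun i => ¬ ⌊Real.log K⌋₊ ≤ i.val).card ≤ ⌊Real.log K⌋₊ := by
    refine (Finset.card_le_card fun i hi => ?_).trans (card_top hK).le
    simp only [Finset.mem_filter, Finset.mem_univ, true_and, not_le] at hi ⊢
    exact hi.2
  rcases (J.filter fun i => ⌊Real.log K⌋₊ ≤ i.val).eq_empty_or_nonempty with hZ | hZ
  · rw [hZ, Finset.card_empty, zero_add] at hsplit
    have hsmall : (K : ℝ) - k ≤ ⌊Real.log K⌋₊ := by
      rw [← hJr, ← hsplit]; exact_mod_cast htop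
    have hce := Finset.card_erase_add_one hz
    have hc1 : 1 ≤ (J.erase ⟨0, h0⟩).card := by omega
    refine ⟨J.erase ⟨0, h0⟩, 1, Finset.notMem_erase _ _, Finset.card_pos.1 hc1, ?_, by norm_num,
      ?_, fun i hi => hle i (Finset.mem_of_mem_erase hi)⟩
    · intro i hi
      rw [Finset.mem_erase] at hi
      have hi0 : i.val ≠ 0 := fun h => hi.1 (Fin.ext h)
      refine le_antisymm (logInstance_le_one hi0) (logInstance_top ?_)
      by_contra hcon
      have : i ∈ J.filter fun i => ⌊Real.log K⌋₊ ≤ i.val :=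
        Finset.mem_filter.2 ⟨hi.2, not_lt.1 hcon⟩
      rw [hZ] at this
      simp at this
    · refine (div_instanceH3_le_half hK hsmall).trans ?_
      have : (1 : ℝ) ≤ (J.erase ⟨0, h0⟩).card := by exact_mod_cast hc1
      rw [le_div_iff₀ (by linarith)]
      linarith
  · have hm1 : (1 : ℝ) ≤ (J.filter fun i => ⌊Real.log K⌋₊ ≤ i.val).card := by
      exact_mod_cast hZ.card_pos
    refine ⟨J.filter fun i => ⌊Real.log K⌋₊ ≤ i.val, 0, ?_, hZ, ?_, by norm_num, ?_,
      fun i hi => hle i (Finset.mem_filter.1 hi).1⟩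
    · simp only [Finset.mem_filter, not_and]
      intro _; omega
    · intro i hi
      exact logInstance_bottom hK (Finset.mem_filter.1 hi).2
    · have hmM : ((J.filter fun i => ⌊Real.log K⌋₊ ≤ i.val).card : ℝ) ≤ bottomCount K := by
        have h1 : (J.filter fun i => ⌊Real.log K⌋₊ ≤ i.val) ⊆
            (Finset.univ.filter fun i : Fin K => i.val < ⌊Real.log K⌋₊)ᶜ := by
          intro i hi
          simp only [Finset.mem_compl, Finset.mem_filter, Finset.mem_univ, true_and, not_lt] at hi ⊢
          exact hi.2
        have h2 := Finset.card_le_card h1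
        rw [Finset.card_compl, card_top hK, Fintype.card_fin] at h2
        rw [bottomCount, ← Nat.cast_sub (floor_log_le_self hK)]
        exact_mod_cast h2
      have hj : (K : ℝ) - k ≤ (J.filter fun i => ⌊Real.log K⌋₊ ≤ i.val).card +
          ⌊Real.log K⌋₊ := by
        rw [← hJr, ← hsplit]; push_cast
        have : ((J.filter fun i => ¬ ⌊Real.log K⌋₊ ≤ i.val).card : ℝ) ≤ ⌊Real.log K⌋₊ := by
          exact_mod_cast htop
        linarith
      refine (div_instanceH3_le hK hm1 hmM hj).trans (le_of_eq ?_)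
      field_simp
      ring

theorem srError_le (hK : 100 ≤ Real.log K) {T : ℕ} (hT : K < T) :
    srError (logInstance K) T ≤ ENNReal.ofReal (Real.exp
      (-((T - K) * srRate (logInstance K) - Real.log (K * 2 ^ K)))) := by
  have h0 := pos_of_log hK
  have hKr : (0 : ℝ) < K := by exact_mod_cast h0
  set bound := ENNReal.ofReal (Real.exp (-((T - K) * srRate (logInstance K)))) with hb
  let good : ℕ → Finset (Fin K) → Prop := fun k S => ∃ p : ℝ,
    (⟨0, pos_of_log hK⟩ : Fin K) ∉ S ∧ S.Nonempty ∧
      (∀ i ∈ S, logInstance K i = p) ∧ p ≤ 2 ∧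
      ((K : ℝ) - k) / instanceH3 K ≤ (2 - p) ^ 2 * S.card / (2 * (S.card + 1))
  let E : ℕ × Finset (Fin K) → Set (RewardTable K) := fun q =>
    {X | good q.1 q.2 ∧ ∀ i ∈ q.2,
      srMean X T (q.1 + 1) ⟨0, pos_of_log hK⟩ ≤ srMean X T (q.1 + 1) i}
  have hsub : {X | ∃ i ∈ srActive X T (K - 1), i ∉ bestArms (logInstance K)} ⊆
      ⋃ q ∈ Finset.range (K - 1) ×ˢ (Finset.univ : Finset (Finset (Fin K))), E q := by
    intro X hX
    obtain ⟨k, hk, S, p, h1, h2, h3, h4, h5, h6⟩ := exists_rejection_witness hK hX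
    simp only [Set.mem_iUnion]
    exact ⟨(k, S), by simp [hk], ⟨p, h1, h2, h3, h4, h5⟩, h6⟩
  have hE : ∀ q ∈ Finset.range (K - 1) ×ˢ (Finset.univ : Finset (Finset (Fin K))),
      rewardLaw (logInstance K) (E q) ≤ bound := by
    intro q hq
    have hq1 : q.1 < K - 1 := by simpa using hq
    by_cases hg : good q.1 q.2
    · have hg' := hg
      obtain ⟨p, h1, h2, h3, h4, h5⟩ := hg'
      exact (measure_mono fun X hX => hX.2).trans
        (srMean_le_prob_logInstance hK hT hq1 h1 h2 h3 h4 h5)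
    · have : E q = ∅ := Set.eq_empty_iff_forall_notMem.2 fun X hX => hg hX.1
      rw [this]; simp
  calc srError (logInstance K) T
      ≤ ∑ q ∈ Finset.range (K - 1) ×ˢ (Finset.univ : Finset (Finset (Fin K))),
          rewardLaw (logInstance K) (E q) :=
        (measure_mono hsub).trans (measure_biUnion_finset_le _ _)
    _ ≤ ∑ q ∈ Finset.range (K - 1) ×ˢ (Finset.univ : Finset (Finset (Fin K))), bound :=
        Finset.sum_le_sum hE
    _ = (((K - 1) * 2 ^ K : ℕ) : ℝ≥0∞) * bound := by
        rw [Finset.sum_const, nsmul_eq_mul]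
        simp
    _ ≤ ENNReal.ofReal (K * 2 ^ K) * bound := by
        gcongr
        rw [← ENNReal.ofReal_natCast]
        refine ENNReal.ofReal_le_ofReal ?_
        simp
    _ = _ := by
        rw [hb, ← ENNReal.ofReal_mul (by positivity), neg_sub,
          sub_eq_add_neg (Real.log _), Real.exp_add,
          Real.exp_log (by positivity)]

theorem le_liminf_srError (hK : 100 ≤ Real.log K) :
    (srRate (logInstance K) : EReal) ≤ liminf (errorExponent (srError (logInstance K))) atTop := by
  refine le_liminf_errorExponent ((eventually_gt_atTop K).mono fun T hT => srError_le hK hT) ?_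
  set r := srRate (logInstance K)
  have h1 : Tendsto (fun T : ℕ => r - (K * r + Real.log (K * 2 ^ K)) / (T : ℝ)) atTop
      (𝓝 (r - 0)) :=
    tendsto_const_nhds.sub (tendsto_const_nhds.div_atTop tendsto_natCast_atTop_atTop)
  rw [sub_zero] at h1
  refine h1.congr' ?_
  filter_upwards [eventually_gt_atTop 0] with T hT
  have : (T : ℝ) ≠ 0 := by exact_mod_cast hT.ne'
  field_simp
  ring

theorem srMean_one (X : RewardTable K) (T : ℕ) (i : Fin K) :
    srMean X T 1 i = rowSum (srLength K T 1) i X / srLength K T 1 := by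
  simp [srMean, rowSum, srLength]

theorem rejected_first {X : RewardTable K} {T : ℕ} (hK1 : 1 < K) {x : ℝ}
    (hn : 0 < srLength K T 1)
    (hz : rowSum (srLength K T 1) ⟨0, by omega⟩ X ≤ srLength K T 1 * x)
    (h : ∀ i : Fin K, i.val ≠ 0 → srLength K T 1 * x ≤ rowSum (srLength K T 1) i X) :
    ∃ i ∈ srActive X T (K - 1), i ≠ ⟨0, by omega⟩ := by
  have hnr : (0 : ℝ) < srLength K T 1 := by exact_mod_cast hn
  have h1 : (⟨0, by omega⟩ : Fin K) ∉ srActive X T 1 := by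
    rw [srActive, Finset.mem_filter]
    rintro ⟨-, j, -, hj⟩
    by_cases hj0 : j.val = 0
    · have : j = ⟨0, by omega⟩ := Fin.ext hj0
      rw [this] at hj
      simp at hj
    · have h2 : srMean X T 1 ⟨0, by omega⟩ ≤ srMean X T 1 j := by
        rw [srMean_one, srMean_one]
        exact div_le_div_of_nonneg_right (hz.trans (h j hj0)) hnr.le
      rcases hj with hj | hj
      · exact absurd hj (not_lt.2 h2)
      · exact absurd hj.2 (by simp [Fin.lt_def])
  have hne : (srActive X T (K - 1)).Nonempty := by
    rw [← Finset.card_pos, card_srActive]; omega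
  obtain ⟨i, hi⟩ := hne
  refine ⟨i, hi, fun h3 => h1 ?_⟩
  rw [← h3]
  exact srActive_antitone X T (show 1 ≤ K - 1 by omega) hi

/-- The constant in the lower bound for the error probability of Successive Rejects. -/
noncomputable def srOffset (K : ℕ) : ℝ :=
  ∑ i : Fin K, (|2 / (bottomCount K + 1) - logInstance K i| + 1)

theorem le_srError (hK : 100 ≤ Real.log K) {T : ℕ} (hn : 0 < srLength K T 1) :
    ENNReal.ofReal (Real.exp (-(srLength K T 1 * (2 * bottomCount K / (bottomCount K + 1)) +
      srOffset K + K * (Real.log (2 * Real.pi * srLength K T 1) / 2)))) ≤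
      srError (logInstance K) T := by
  have h0 := pos_of_log hK
  have hM := bottomCount_gt hK
  have hM0 : 0 < bottomCount K := by linarith
  have hL := one_lt_floor_log hK
  have hK1 : 1 < K := hL.trans_le (floor_log_le_self hK)
  set n := srLength K T 1 with hndef
  set x := 2 / (bottomCount K + 1) with hx
  have hx1 : x ≤ 1 := by rw [hx, div_le_one (by linarith)]; linarith
  have hx0 : 0 ≤ x := by positivity
  set P := logInstance K with hP
  let E : Fin K → Set ℝ := fun i => if i.val = 0 then Set.Iic (n * x) else Set.Ici (n * x)
  have hE : ∀ i, MeasurableSet (E i) := fun i => by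
    dsimp only [E]; split_ifs
    · exact measurableSet_Iic
    · exact measurableSet_Ici
  let a : Fin K → ℝ := fun i =>
    if i.val = 0 then 2 - x else if i.val < ⌊Real.log K⌋₊ then 0 else x
  have hprob : ∀ i, ENNReal.ofReal (Real.exp (-(n * (a i ^ 2 / 2) + (|x - P i| + 1) +
      Real.log (2 * Real.pi * n) / 2))) ≤ rewardLaw P {X | rowSum n i X ∈ E i} := by
    intro i
    by_cases hi : i.val = 0
    · have hPi : P i = 2 := by simp [hP, logInstance, hi]
      have h1 := rowSum_le_prob P hn i (x := x) (by rw [hPi]; linarith)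
      simp only [E, a, if_pos hi]
      refine le_trans (ENNReal.ofReal_le_ofReal (Real.exp_le_exp.2 (neg_le_neg ?_))) h1
      rw [hPi, abs_sub_comm, abs_of_nonneg (by linarith : (0 : ℝ) ≤ 2 - x)]
      linarith
    · have h1 := rowSum_ge_prob P hn i x
      have h2 : max (x - P i) 0 = a i := by
        simp only [a, if_neg hi]
        split_ifs with hiL
        · exact max_eq_right (by linarith [logInstance_top hiL])
        · rw [hP, logInstance_bottom hK (not_lt.1 hiL), sub_zero, max_eq_left hx0]
      have h3 : max (x - P i) 0 ≤ |x - P i| := max_le (le_abs_self _) (abs_nonneg _)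
      simp only [E, if_neg hi]
      refine le_trans (ENNReal.ofReal_le_ofReal (Real.exp_le_exp.2 (neg_le_neg ?_))) h1
      rw [h2] at h3 ⊢
      linarith
  have hsum : ∑ i, (n * (a i ^ 2 / 2) + (|x - P i| + 1) + Real.log (2 * Real.pi * n) / 2) =
      n * (2 * bottomCount K / (bottomCount K + 1)) + srOffset K +
        K * (Real.log (2 * Real.pi * n) / 2) := by
    rw [Finset.sum_add_distrib, Finset.sum_add_distrib, ← Finset.mul_sum, Finset.sum_const,
      Finset.card_univ, Fintype.card_fin, nsmul_eq_mul, srOffset]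
    congr 3
    have h1 : ∀ i : Fin K, a i ^ 2 / 2 = if i.val = 0 then (2 - x) ^ 2 / 2 else
        if i.val < ⌊Real.log K⌋₊ then 0 else x ^ 2 / 2 := by
      intro i
      simp only [a]
      split_ifs <;> norm_num
    simp_rw [h1]
    rw [sum_three_groups hK, hx]
    field_simp
    ring
  calc _ = ∏ i, ENNReal.ofReal (Real.exp (-(n * (a i ^ 2 / 2) + (|x - P i| + 1) +
        Real.log (2 * Real.pi * n) / 2))) := by
        rw [← ENNReal.ofReal_prod_of_nonneg fun i _ => (Real.exp_pos _).le, ← Real.exp_sum,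
          Finset.sum_neg_distrib, hsum]
    _ ≤ ∏ i, rewardLaw P {X | rowSum n i X ∈ E i} := Finset.prod_le_prod' fun i _ => hprob i
    _ = rewardLaw P {X | ∀ i ∈ Finset.univ, rowSum n i X ∈ E i} :=
        (rewardLaw_rowSum_mem P n E hE Finset.univ).symm
    _ ≤ _ := by
        refine measure_mono fun X hX => ?_
        obtain ⟨i, hi, hne⟩ := rejected_first (X := X) (T := T) hK1 (x := x) hn
          (by have := hX ⟨0, h0⟩ (Finset.mem_univ _); simpa [E] using this)
          (fun i hi => by
            have := hX i (Finset.mem_univ _)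
            simpa only [E, if_neg hi, Set.mem_Ici] using this)
        exact ⟨i, hi, by rw [bestArms_logInstance h0, Finset.mem_singleton]; exact hne⟩

theorem tendsto_srLength_div (hK : 100 ≤ Real.log K) :
    Tendsto (fun T : ℕ => (srLength K T 1 : ℝ) / T) atTop (𝓝 (1 / (logBar K * K))) := by
  have hKr : (0 : ℝ) < K := by exact_mod_cast pos_of_log hK
  have hlb := logBar_pos hK
  have hl : Tendsto (fun T : ℕ => 1 / (logBar K * K) - (K / (logBar K * K)) / (T : ℝ)) atTop
      (𝓝 (1 / (logBar K * K) - 0)) :=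
    tendsto_const_nhds.sub (tendsto_const_nhds.div_atTop tendsto_natCast_atTop_atTop)
  have hu : Tendsto (fun T : ℕ => 1 / (logBar K * K) + 1 / (T : ℝ)) atTop
      (𝓝 (1 / (logBar K * K) + 0)) :=
    tendsto_const_nhds.add (tendsto_const_nhds.div_atTop tendsto_natCast_atTop_atTop)
  rw [sub_zero] at hl
  rw [add_zero] at hu
  refine tendsto_of_tendsto_of_tendsto_of_le_of_le' hl hu ?_ ?_
  · filter_upwards [eventually_gt_atTop 0] with T hT
    have hTr : (0 : ℝ) < T := by exact_mod_cast hT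
    have h1 := le_srLength (K := K) T 0
    rw [Nat.cast_zero, sub_zero, zero_add] at h1
    rw [le_div_iff₀ hTr]
    refine le_trans (le_of_eq ?_) h1
    field_simp
  · filter_upwards [eventually_gt_atTop K] with T hT
    have hTr : (K : ℝ) < T := by exact_mod_cast hT
    have hT0 : (0 : ℝ) < T := by linarith
    have h1 : (srLength K T 1 : ℝ) ≤ ((T : ℝ) - K) / (logBar K * K) + 1 := by
      rw [srLength, if_neg one_ne_zero]
      have := (Nat.ceil_lt_add_one (show 0 ≤ ((T : ℝ) - K) /
        (logBar K * ((K : ℝ) + 1 - (1 : ℕ))) by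
          have : (K : ℝ) + 1 - (1 : ℕ) = K := by push_cast; ring
          rw [this]
          exact div_nonneg (by linarith) (by positivity))).le
      refine this.trans (le_of_eq ?_)
      push_cast
      congr 3
      ring
    rw [div_le_iff₀ hT0]
    refine h1.trans ?_
    have h2 : ((T : ℝ) - K) / (logBar K * K) ≤ T / (logBar K * K) := by gcongr; linarith
    calc _ ≤ (T : ℝ) / (logBar K * K) + 1 := by linarith
      _ = _ := by field_simp

theorem limsup_srError_le (hK : 100 ≤ Real.log K) :
    limsup (errorExponent (srError (logInstance K))) atTop ≤ (srRate (logInstance K) : EReal) := by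
  have hKr : (0 : ℝ) < K := by exact_mod_cast pos_of_log hK
  have hlb := logBar_pos hK
  have hM := bottomCount_gt hK
  have hM0 : 0 < bottomCount K := by linarith
  have hdiv := tendsto_srLength_div hK
  have hlim : Tendsto (fun T : ℕ => (srLength K T 1 : ℝ)) atTop atTop := by
    have h1 : Tendsto (fun T : ℕ => (srLength K T 1 : ℝ) / T * T) atTop atTop :=
      hdiv.pos_mul_atTop (by positivity) tendsto_natCast_atTop_atTop
    refine h1.congr' ?_
    filter_upwards [eventually_gt_atTop 0] with T hT
    have : (T : ℝ) ≠ 0 := by exact_mod_cast hT.ne'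
    field_simp
  refine limsup_errorExponent_le ((hlim.eventually_gt_atTop 0).mono fun T hT =>
    le_srError hK (by exact_mod_cast hT)) ?_
  have hlog : Tendsto (fun T : ℕ => Real.log (2 * Real.pi * srLength K T 1) / T) atTop (𝓝 0) := by
    have h1 : Tendsto (fun y : ℝ => Real.log y / y) atTop (𝓝 0) :=
      Real.isLittleO_log_id_atTop.tendsto_div_nhds_zero
    have h2 : Tendsto (fun T : ℕ => 2 * Real.pi * (srLength K T 1 : ℝ)) atTop atTop :=
      hlim.const_mul_atTop (by have := Real.pi_pos; positivity)
    have h3 := ((h1.comp h2).mul (hdiv.const_mul (2 * Real.pi)))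
    rw [zero_mul] at h3
    refine h3.congr' ?_
    filter_upwards [h2.eventually_gt_atTop 0] with T hT
    simp only [Function.comp_apply]
    have hn : (srLength K T 1 : ℝ) ≠ 0 := fun h => by rw [h, mul_zero] at hT; exact lt_irrefl _ hT
    have := Real.pi_ne_zero
    field_simp
  have h1 := ((hdiv.mul_const (2 * bottomCount K / (bottomCount K + 1))).add
    (tendsto_const_nhds (x := srOffset K).div_atTop tendsto_natCast_atTop_atTop)).add
    ((hlog.div_const 2).const_mul (K : ℝ))
  have hr : srRate (logInstance K) = 1 / (logBar K * K) *
      (2 * bottomCount K / (bottomCount K + 1)) + 0 + K * (0 / 2) := by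
    rw [srRate, riskH3_logInstance hK, instanceH3]
    field_simp
    ring
  rw [hr]
  refine h1.congr fun T => ?_
  ring

theorem tendsto_srError (hK : 100 ≤ Real.log K) :
    Tendsto (errorExponent (srError (logInstance K))) atTop
      (𝓝 ((srRate (logInstance K) : ℝ) : EReal)) :=
  tendsto_of_le_liminf_of_limsup_le (le_liminf_srError hK) (limsup_srError_le hK)

end successiveRejects

/-! ## Almost Tracking: pulls and weights -/

section almostTracking

variable {K : ℕ}

theorem le_roundAlloc {w : Fin K → ℝ} (hw : ∀ i, 0 ≤ w i) (N : ℕ) (u : ℕ → unitInterval)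
    (i : Fin K) : ((N : ℝ) - K) * w i ≤ roundAlloc w N u i := by
  have h1 : ((N : ℝ) - K) * w i ≤ roundBase w N i := by
    unfold roundBase
    split_ifs with h
    · have h2 : ((Finset.univ.filter fun j => 0 < w j).card : ℝ) ≤ K := by
        exact_mod_cast (Finset.card_le_univ _).trans (by simp)
      have h3 := Nat.lt_floor_add_one
        (w i * ((N : ℝ) - (Finset.univ.filter fun j => 0 < w j).card))
      push_cast
      nlinarith [hw i]
    · have : w i = 0 := le_antisymm (not_lt.1 h) (hw i)
      simp [this]
  refine h1.trans ?_
  rw [roundAlloc]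
  exact_mod_cast Nat.le_add_right _ _

theorem roundAlloc_lt {w : Fin K → ℝ} (hw1 : ∀ i, w i ≤ 1) (N : ℕ)
    (u : ℕ → unitInterval) (i : Fin K) : roundAlloc w N u i < 2 * N + 2 := by
  have h1 : roundBase w N i ≤ 1 + N := by
    unfold roundBase
    split_ifs
    · refine Nat.add_le_add_left (Nat.floor_le_of_le ?_) 1
      have : (0 : ℝ) ≤ (Finset.univ.filter fun j => 0 < w j).card := Nat.cast_nonneg _
      have hN : (0 : ℝ) ≤ N := Nat.cast_nonneg _
      nlinarith [hw1 i]
    · omega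
  have h2 := (Finset.card_filter_le (Finset.range (N - ∑ j, roundBase w N j)) fun m =>
      ∑ j ∈ Finset.univ.filter (fun j => j < i), w j ≤ (u m : ℝ) ∧
        (u m : ℝ) < ∑ j ∈ Finset.univ.filter (fun j => j ≤ i), w j)
  rw [Finset.card_range] at h2
  rw [roundAlloc]
  omega

theorem nextWeight_nonneg (Csuf : ℝ) (b : ℕ) (s : ATState K) (i : Fin K) :
    0 ≤ s.nextWeight allocStar Csuf b i := by
  unfold ATState.nextWeight
  split_ifs
  · positivity
  · exact div_nonneg (allocStar_pos _ _).le (Finset.sum_nonneg fun j _ => (allocStar_pos _ _).le)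
  · exact le_rfl

theorem nextWeight_le_one (Csuf : ℝ) (b : ℕ) (s : ATState K) (i : Fin K) :
    s.nextWeight allocStar Csuf b i ≤ 1 := by
  unfold ATState.nextWeight
  split_ifs with h1 h2
  · have : (1 : ℝ) ≤ K := by exact_mod_cast i.pos
    exact (div_le_one (by linarith)).2 this
  · exact div_le_one_of_le₀ (Finset.single_le_sum (f := fun j => allocStar s.mean j)
      (fun j _ => (allocStar_pos _ _).le) h2) (Finset.sum_nonneg fun j _ => (allocStar_pos _ _).le)
  · exact zero_le_one

theorem allocStar_le_nextWeight {Csuf : ℝ} {b : ℕ} (hb : b ≠ 0) {s : ATState K} {i : Fin K}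
    (hi : i ∈ s.insufficient allocStar Csuf b) :
    allocStar s.mean i ≤ s.nextWeight allocStar Csuf b i := by
  rw [ATState.nextWeight, if_neg hb, if_pos hi]
  have h1 : ∑ j ∈ s.insufficient allocStar Csuf b, allocStar s.mean j ≤ 1 := by
    rw [← sum_allocStar s.mean i]
    exact Finset.sum_le_sum_of_subset_of_nonneg (Finset.subset_univ _)
      fun j _ _ => (allocStar_pos _ _).le
  have h2 : 0 < ∑ j ∈ s.insufficient allocStar Csuf b, allocStar s.mean j :=
    Finset.sum_pos (fun j _ => allocStar_pos _ _) ⟨i, hi⟩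
  rw [le_div_iff₀ h2]
  nlinarith [allocStar_pos s.mean i]

variable (Csuf : ℝ) (N : ℕ) (X : RewardTable K) (U : ℕ × ℕ → unitInterval)

/-- The number of pulls of an arm within a batch of Almost Tracking. -/
noncomputable def batchPulls (b : ℕ) : Fin K → ℕ :=
  roundAlloc ((atState allocStar Csuf N X U b).nextWeight allocStar Csuf b) N fun m => U (b, m)

theorem atState_pulls_succ (b : ℕ) (i : Fin K) :
    (atState allocStar Csuf N X U (b + 1)).pulls i =
      (atState allocStar Csuf N X U b).pulls i + batchPulls Csuf N X U b i := rfl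

theorem atState_total_succ (b : ℕ) (i : Fin K) :
    (atState allocStar Csuf N X U (b + 1)).total i =
      (atState allocStar Csuf N X U b).total i +
        ∑ m ∈ Finset.range (batchPulls Csuf N X U b i), X (b, i, m) := rfl

theorem atState_weight_succ (b : ℕ) (i : Fin K) :
    (atState allocStar Csuf N X U (b + 1)).weight i =
      (atState allocStar Csuf N X U b).weight i +
        (atState allocStar Csuf N X U b).nextWeight allocStar Csuf b i := rfl

theorem batchPulls_lt (b : ℕ) (i : Fin K) : batchPulls Csuf N X U b i < 2 * N + 2 :=
  roundAlloc_lt (fun _ => nextWeight_le_one _ _ _ _) _ _ _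

theorem le_batchPulls (b : ℕ) (i : Fin K) :
    ((N : ℝ) - K) * (atState allocStar Csuf N X U b).nextWeight allocStar Csuf b i ≤
      batchPulls Csuf N X U b i := by
  have h := le_roundAlloc (nextWeight_nonneg Csuf b (atState allocStar Csuf N X U b)) N
    (fun m => U (b, m)) i
  rw [batchPulls]
  exact h

theorem atState_pulls (b : ℕ) (i : Fin K) :
    (atState allocStar Csuf N X U b).pulls i =
      ∑ a ∈ Finset.range b, batchPulls Csuf N X U a i := by
  induction b with
  | zero => rfl
  | succ b ih => rw [atState_pulls_succ, ih, Finset.sum_range_succ]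

theorem atState_total (b : ℕ) (i : Fin K) :
    (atState allocStar Csuf N X U b).total i =
      ∑ a ∈ Finset.range b, ∑ m ∈ Finset.range (batchPulls Csuf N X U a i), X (a, i, m) := by
  induction b with
  | zero => rfl
  | succ b ih => rw [atState_total_succ, ih, Finset.sum_range_succ]

theorem atState_total_eq_mul (b : ℕ) (i : Fin K) :
    (atState allocStar Csuf N X U b).total i =
      (atState allocStar Csuf N X U b).pulls i * (atState allocStar Csuf N X U b).mean i := by
  rw [ATState.mean]
  by_cases h : (atState allocStar Csuf N X U b).pulls i = 0
  · rw [h, Nat.cast_zero, zero_mul, atState_total]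
    rw [atState_pulls, Finset.sum_eq_zero_iff] at h
    refine Finset.sum_eq_zero fun a ha => ?_
    rw [h a ha, Finset.range_zero, Finset.sum_empty]
  · have : ((atState allocStar Csuf N X U b).pulls i : ℝ) ≠ 0 := by exact_mod_cast h
    field_simp

theorem weight_nonneg (b : ℕ) (i : Fin K) : 0 ≤ (atState allocStar Csuf N X U b).weight i := by
  induction b with
  | zero => exact le_rfl
  | succ b ih =>
    rw [atState_weight_succ]
    exact add_nonneg ih (nextWeight_nonneg _ _ _ _)

theorem mul_weight_le_pulls (b : ℕ) (i : Fin K) :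
    ((N : ℝ) - K) * (atState allocStar Csuf N X U b).weight i ≤
      (atState allocStar Csuf N X U b).pulls i := by
  induction b with
  | zero => simp [atState]
  | succ b ih =>
    rw [atState_weight_succ, atState_pulls_succ, mul_add]
    push_cast
    exact add_le_add ih (le_batchPulls Csuf N X U b i)

variable {Csuf}

/-- An arm whose target allocation is at least `q` from batch `a` on receives at least
a `q`-share of the batches from then on. -/
theorem mul_sub_le_weight (hC0 : 0 < Csuf) (hC1 : Csuf < 1) {q : ℝ} (hq : 0 ≤ q) {i : Fin K}
    {a : ℕ} (ha : 1 ≤ a) {b : ℕ} (hab : a ≤ b)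
    (h : ∀ d, a ≤ d → d < b → q ≤ allocStar (atState allocStar Csuf N X U d).mean i) :
    q * ((b : ℝ) - a) ≤ (atState allocStar Csuf N X U b).weight i := by
  induction b, hab using Nat.le_induction with
  | base => simpa using weight_nonneg Csuf N X U a i
  | succ b hab ih =>
    have ih' := ih fun d h1 h2 => h d h1 (by omega)
    have hqb := h b hab (by omega)
    rw [atState_weight_succ]
    set s := atState allocStar Csuf N X U b with hs
    push_cast
    by_cases hi : i ∈ s.insufficient allocStar Csuf b
    · have := allocStar_le_nextWeight (show b ≠ 0 by omega) hi
      linarith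
    · have h1 : 1 / Csuf * allocStar s.mean i < s.weight i / b := by
        simpa [ATState.insufficient] using hi
      have hbr : (0 : ℝ) < b := by exact_mod_cast (show 0 < b by omega)
      have har : (1 : ℝ) ≤ a := by exact_mod_cast ha
      have h2 : (1 : ℝ) ≤ 1 / Csuf := by rw [le_div_iff₀ hC0]; linarith
      have h3 : q ≤ 1 / Csuf * allocStar s.mean i := by nlinarith
      have h4 : q < s.weight i / b := h3.trans_lt h1
      rw [lt_div_iff₀ hbr] at h4
      have := nextWeight_nonneg Csuf b s i
      nlinarith

variable {N}

theorem mul_sub_le_pulls (hC0 : 0 < Csuf) (hC1 : Csuf < 1) (hN : 2 * K ≤ N) {q : ℝ} (hq : 0 ≤ q)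
    {i : Fin K} {a : ℕ} (ha : 1 ≤ a) {b : ℕ} (hab : a ≤ b)
    (h : ∀ d, a ≤ d → d < b → q ≤ allocStar (atState allocStar Csuf N X U d).mean i) :
    N / 2 * (q * ((b : ℝ) - a)) ≤ (atState allocStar Csuf N X U b).pulls i := by
  have h1 := mul_sub_le_weight N X U hC0 hC1 hq ha hab h
  have h2 := mul_weight_le_pulls Csuf N X U b i
  have hNr : 2 * (K : ℝ) ≤ N := by exact_mod_cast hN
  have h3 := weight_nonneg Csuf N X U b i
  have h4 : (0 : ℝ) ≤ N := Nat.cast_nonneg _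
  calc N / 2 * (q * ((b : ℝ) - a))
      ≤ N / 2 * (atState allocStar Csuf N X U b).weight i :=
        mul_le_mul_of_nonneg_left h1 (by positivity)
    _ ≤ ((N : ℝ) - K) * (atState allocStar Csuf N X U b).weight i :=
        mul_le_mul_of_nonneg_right (by linarith) h3
    _ ≤ _ := h2

/-- The number of pulls whose rewards have to deviate for Almost Tracking to err. -/
noncomputable def deviationBudget (K N B : ℕ) : ℝ :=
  B * N / (112 * (K * Real.log (Real.log K)))

/-- If Almost Tracking errs after `B` batches, then after some number of batches the empirical
means of a heavily pulled group of arms are off by at least `1/4`. -/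
theorem exists_deviation (hK : 100 ≤ Real.log K) (hC0 : 0 < Csuf) (hC1 : Csuf < 1)
    (hN : 2 * K ≤ N) {B : ℕ} (hB : 8 ≤ B)
    (herr : ∃ i ∈ bestArms (atState allocStar Csuf N X U B).mean, i ∉ bestArms (logInstance K)) :
    ∃ b ≤ B, ∃ A : Finset (Fin K),
      (∀ i ∈ A, 1 / 4 ≤ |(atState allocStar Csuf N X U b).mean i - logInstance K i|) ∧
      deviationBudget K N B ≤ ∑ i ∈ A, ((atState allocStar Csuf N X U b).pulls i : ℝ) := by
  have h0 := pos_of_log hK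
  have hKr : (0 : ℝ) < K := by exact_mod_cast h0
  have hll := one_le_log_log hK
  have hLge := le_floor_log hK
  have hNr : (0 : ℝ) < N := by exact_mod_cast (show 0 < N by omega)
  have hBr : (8 : ℝ) ≤ B := by exact_mod_cast hB
  by_contra! hcon
  set a := B / 4 + 2 with ha
  have ha1 : (B : ℝ) / 4 ≤ (a : ℝ) - 1 := by
    have h1 : B ≤ 4 * (a - 1) := by omega
    have h2 : (B : ℝ) ≤ 4 * ((a - 1 : ℕ) : ℝ) := by exact_mod_cast h1
    rw [Nat.cast_sub (by omega)] at h2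
    push_cast at h2
    linarith
  have ha2 : (B : ℝ) / 2 ≤ (B : ℝ) - a := by
    have h1 : B + 2 * a ≤ 2 * B := by omega
    have h2 : (B : ℝ) + 2 * a ≤ 2 * B := by exact_mod_cast h1
    linarith
  have hbudget : ∀ y : ℝ, y ≤ 112 * (K * Real.log (Real.log K)) → 0 < y →
      deviationBudget K N B ≤ B * N / y := fun y hy hy0 =>
    div_le_div_of_nonneg_left (by positivity) hy0 hy
  have hcrude : ∀ b, a ≤ b → ∀ i, B * N / (40 * (K * Real.log K)) ≤
      ((atState allocStar Csuf N X U b).pulls i : ℝ) := by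
    intro b hb i
    have hq0 : 0 ≤ 1 / (K * (5 * Real.log K)) := by positivity
    have h1 := mul_sub_le_pulls X U hC0 hC1 hN hq0 (i := i) (a := 1) le_rfl (b := b) (by omega)
      fun d _ _ => le_allocStar (by linarith) (fun hQ => normZ_le_five_log hK hQ) i
    refine le_trans ?_ h1
    have hbr : (a : ℝ) ≤ b := by exact_mod_cast hb
    calc (B : ℝ) * N / (40 * (K * Real.log K))
        = N / 2 * (1 / (K * (5 * Real.log K)) * (B / 4)) := by field_simp; norm_num
      _ ≤ _ := by
        push_cast
        gcongr
        linarith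
  have hcard : ∀ b, a ≤ b → b ≤ B → ∀ A : Finset (Fin K),
      (∀ i ∈ A, 1 / 4 ≤ |(atState allocStar Csuf N X U b).mean i - logInstance K i|) →
      (A.card : ℝ) < Real.log K / 2 := by
    intro b hab hbB A hA
    have h1 := hcon b hbB A hA
    have h2 : (A.card : ℝ) * (B * N / (40 * (K * Real.log K))) ≤
        ∑ i ∈ A, ((atState allocStar Csuf N X U b).pulls i : ℝ) := by
      rw [← nsmul_eq_mul, ← Finset.sum_const]
      exact Finset.sum_le_sum fun i _ => hcrude b hab i
    have h3 := hbudget (80 * K) (by nlinarith) (by positivity)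
    by_contra! h4
    have h5 : Real.log K / 2 * (B * N / (40 * (K * Real.log K))) ≤
        (A.card : ℝ) * (B * N / (40 * (K * Real.log K))) := by gcongr
    have h6 : Real.log K / 2 * (B * N / (40 * (K * Real.log K))) = B * N / (80 * K) := by
      field_simp; norm_num
    linarith
  have hfine : ∀ b, a ≤ b → b ≤ B → ∀ i, 1 / (K * (28 * Real.log (Real.log K))) ≤
      allocStar (atState allocStar Csuf N X U b).mean i := by
    intro b hab hbB i
    set Q := (atState allocStar Csuf N X U b).mean
    refine le_allocStar (by linarith) (fun hQ => ?_) i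
    have hd := hcard b hab hbB (deviatingArms Q) fun j hj => by
      simp only [deviatingArms, Finset.mem_filter, Finset.mem_univ, true_and] at hj
      rw [logInstance_bottom hK hj.1, sub_zero]
      exact hj.2
    obtain ⟨m, hm⟩ : ∃ m, 1 / 2 ≤ Q m := by
      by_contra! hm
      have h1 := hcard b hab hbB (Finset.univ.filter fun i : Fin K => i.val < ⌊Real.log K⌋₊)
        fun j hj => by
          simp only [Finset.mem_filter, Finset.mem_univ, true_and] at hj
          have h2 := logInstance_top hj
          have h3 := hm j
          rw [abs_sub_comm]
          exact le_trans (by linarith) (le_abs_self _)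
      rw [card_top hK] at h1
      linarith
    exact normZ_le_log_log hK hQ hm (by linarith)
  have hfinal : ∀ i, deviationBudget K N B ≤
      ((atState allocStar Csuf N X U B).pulls i : ℝ) := by
    intro i
    have h1 := mul_sub_le_pulls X U hC0 hC1 hN (q := 1 / (K * (28 * Real.log (Real.log K))))
      (by positivity) (i := i) (a := a) (by omega) (b := B) (by omega)
      fun d hd1 hd2 => hfine d hd1 hd2.le i
    refine le_trans ?_ h1
    calc deviationBudget K N B
        = N / 2 * (1 / (K * (28 * Real.log (Real.log K))) * (B / 2)) := by
          rw [deviationBudget]; field_simp; norm_num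
      _ ≤ _ := by gcongr
  have hsmall : ∀ i, |(atState allocStar Csuf N X U B).mean i - logInstance K i| < 1 / 4 := by
    intro i
    by_contra! h1
    have h2 := hcon B le_rfl {i} (by simpa using h1)
    rw [Finset.sum_singleton] at h2
    exact absurd (hfinal i) (not_le.2 h2)
  obtain ⟨i, hi, hi'⟩ := herr
  rw [bestArms_logInstance h0, Finset.mem_singleton] at hi'
  have h1 := (mem_bestArms _).1 hi ⟨0, h0⟩
  have h2 := logInstance_le_one (i := i) fun h => hi' (Fin.ext h)
  have h3 := (abs_lt.1 (hsmall i)).2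
  have h4 := (abs_lt.1 (hsmall ⟨0, h0⟩)).1
  rw [logInstance_zero] at h4
  linarith

end almostTracking

/-! ## Almost Tracking: the probability of error -/

section almostTrackingError

variable {K : ℕ}

/-- A deterministic schedule of pulls, read off a table with `B` batches. -/
def scheduleOf {B M : ℕ} (ν : Fin B → Fin K → Fin M) (b : ℕ) (i : Fin K) : ℕ :=
  if h : b < B then ν ⟨b, h⟩ i else 0

/-- The event that the rewards which the schedule `ν` collects from the arms with `τ_i ≠ 0`
deviate by `1/4` on average in the directions `τ`. -/
def deviationEvent (P : Fin K → ℝ) (b : ℕ) (τ : Fin K → SignType) (ν : ℕ → Fin K → ℕ) (y : ℝ) :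
    Set (RewardTable K) :=
  {X | y ≤ ∑ a ∈ Finset.range b, ∑ i, (ν a i : ℝ) * (τ i : ℝ) ^ 2 ∧
    (1 / 4 : ℝ) * ∑ a ∈ Finset.range b, ∑ i, (ν a i : ℝ) * (τ i : ℝ) ^ 2 ≤
      ∑ a ∈ Finset.range b, ∑ i, ∑ s ∈ Finset.range (ν a i), (τ i : ℝ) * (X (a, i, s) - P i)}

theorem deviationEvent_prob (P : Fin K → ℝ) (b : ℕ) (τ : Fin K → SignType) (ν : ℕ → Fin K → ℕ)
    {y : ℝ} (hy : 0 < y) :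
    rewardLaw P (deviationEvent P b τ ν y) ≤ ENNReal.ofReal (Real.exp (-(y / 32))) := by
  set V := ∑ a ∈ Finset.range b, ∑ i, (ν a i : ℝ) * (τ i : ℝ) ^ 2 with hV
  by_cases hyV : y ≤ V
  · have hV0 : 0 < V := hy.trans_le hyV
    refine (measure_mono fun X hX => hX.2).trans ((reward_tail P b ν (fun i => (τ i : ℝ))
      (t := 1 / 4 * V) (by positivity)).trans ?_)
    refine ENNReal.ofReal_le_ofReal (Real.exp_le_exp.2 ?_)
    rw [← hV, neg_div, neg_le_neg_iff]
    have : (1 / 4 * V) ^ 2 / (2 * V) = V / 32 := by field_simp; norm_num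
    rw [this]
    linarith
  · have : deviationEvent P b τ ν y = ∅ :=
      Set.eq_empty_iff_forall_notMem.2 fun X hX => hyV hX.1
    rw [this]
    simp

theorem mem_deviationEvent {P : Fin K → ℝ} {Csuf : ℝ} {N b : ℕ} {X : RewardTable K}
    {U : ℕ × ℕ → unitInterval} {A : Finset (Fin K)} {y : ℝ}
    (hA : ∀ i ∈ A, 1 / 4 ≤ |(atState allocStar Csuf N X U b).mean i - P i|)
    (hy : y ≤ ∑ i ∈ A, ((atState allocStar Csuf N X U b).pulls i : ℝ))
    {ν : ℕ → Fin K → ℕ} (hν : ∀ a < b, ∀ i, ν a i = batchPulls Csuf N X U a i) :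
    ∃ τ : Fin K → SignType, X ∈ deviationEvent P b τ ν y := by
  set s := atState allocStar Csuf N X U b with hs
  let τ : Fin K → SignType := fun i => if i ∈ A then SignType.sign (s.mean i - P i) else 0
  have hpulls : ∀ i, ∑ a ∈ Finset.range b, (ν a i : ℝ) = s.pulls i := by
    intro i
    rw [hs, atState_pulls, Nat.cast_sum]
    exact Finset.sum_congr rfl fun a ha => by rw [hν a (Finset.mem_range.1 ha)]
  have htotal : ∀ i, ∑ a ∈ Finset.range b, ∑ m ∈ Finset.range (ν a i), (X (a, i, m) - P i) =
      s.pulls i * (s.mean i - P i) := by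
    intro i
    have h1 : ∑ a ∈ Finset.range b, ∑ m ∈ Finset.range (ν a i), X (a, i, m) = s.total i := by
      rw [hs, atState_total]
      exact Finset.sum_congr rfl fun a ha => by rw [hν a (Finset.mem_range.1 ha)]
    simp_rw [Finset.sum_sub_distrib, Finset.sum_const, Finset.card_range, nsmul_eq_mul]
    rw [← Finset.sum_mul, hpulls, h1, hs, atState_total_eq_mul]
    ring
  have hV : ∑ a ∈ Finset.range b, ∑ i, (ν a i : ℝ) * (τ i : ℝ) ^ 2 =
      ∑ i, (s.pulls i : ℝ) * (τ i : ℝ) ^ 2 := by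
    rw [Finset.sum_comm]
    exact Finset.sum_congr rfl fun i _ => by rw [← Finset.sum_mul, hpulls]
  have hτ : ∀ i, (τ i : ℝ) ^ 2 = if i ∈ A then 1 else 0 := by
    intro i
    by_cases hi : i ∈ A
    · have h1 := hA i hi
      have h2 : s.mean i - P i ≠ 0 := fun h => by rw [h, abs_zero] at h1; norm_num at h1
      simp only [τ, if_pos hi]
      rcases lt_or_gt_of_ne h2 with h | h
      · rw [sign_neg h]; simp
      · rw [sign_pos h]; simp
    · simp [τ, hi]
  refine ⟨τ, ?_, ?_⟩
  · rw [hV]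
    refine hy.trans (le_of_eq ?_)
    simp_rw [hτ, mul_ite, mul_one, mul_zero]
    rw [Finset.sum_ite_mem, Finset.univ_inter]
  · rw [hV, Finset.sum_comm, Finset.mul_sum]
    refine Finset.sum_le_sum fun i _ => ?_
    simp_rw [← Finset.mul_sum]
    rw [htotal, hτ]
    by_cases hi : i ∈ A
    · have h1 := hA i hi
      have h2 : (τ i : ℝ) * (s.mean i - P i) = |s.mean i - P i| := by
        simp only [τ, if_pos hi]
        exact sign_mul_self _
      rw [if_pos hi]
      calc (1 / 4 : ℝ) * (s.pulls i * 1) = s.pulls i * (1 / 4) := by ring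
        _ ≤ s.pulls i * |s.mean i - P i| := mul_le_mul_of_nonneg_left h1 (Nat.cast_nonneg _)
        _ = _ := by rw [← h2]; ring
    · simp [τ, hi]

theorem atError_le (hK : 100 ≤ Real.log K) {Csuf : ℝ} (hC0 : 0 < Csuf) (hC1 : Csuf < 1)
    {N T : ℕ} (hN : 2 * K ≤ N) (hB : 8 ≤ T / N) :
    atError allocStar Csuf (logInstance K) N T ≤ ENNReal.ofReal (Real.exp
      (-(deviationBudget K N (T / N) / 32 - (Real.log ((T / N : ℕ) + 1) + K * Real.log 3 +
        (T / N : ℕ) * K * Real.log (2 * N + 2))))) := by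
  have h0 := pos_of_log hK
  have hKr : (0 : ℝ) < K := by exact_mod_cast h0
  have hNr : (0 : ℝ) < N := by exact_mod_cast (show 0 < N by omega)
  have hll := one_le_log_log hK
  set B := T / N with hBdef
  have hBr : (0 : ℝ) < B := by exact_mod_cast (show 0 < B by omega)
  set y := deviationBudget K N B with hy
  have hy0 : 0 < y := by rw [hy, deviationBudget]; positivity
  set P := logInstance K with hP
  let I := Fin (B + 1) × (Fin K → SignType) × (Fin B → Fin K → Fin (2 * N + 2))
  let E : I → Set (RewardTable K) := fun q =>
    deviationEvent P q.1 q.2.1 (scheduleOf q.2.2) y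
  have hsub : {ω : RewardTable K × (ℕ × ℕ → unitInterval) |
      ∃ i ∈ bestArms (atState allocStar Csuf N ω.1 ω.2 B).mean, i ∉ bestArms P} ⊆
      (⋃ q, E q) ×ˢ Set.univ := by
    rintro ⟨X, U⟩ herr
    obtain ⟨b, hb, A, hA, hAy⟩ := exists_deviation X U hK hC0 hC1 hN hB herr
    let ν : Fin B → Fin K → Fin (2 * N + 2) := fun a i =>
      ⟨batchPulls Csuf N X U a i, batchPulls_lt Csuf N X U a i⟩
    obtain ⟨τ, hτ⟩ := mem_deviationEvent (ν := scheduleOf ν) hA hAy fun a ha i => by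
      rw [scheduleOf, dif_pos (ha.trans_le hb)]
    refine ⟨Set.mem_iUnion.2 ⟨(⟨b, by omega⟩, τ, ν), hτ⟩, Set.mem_univ _⟩
  have hcard : (Fintype.card I : ℝ) = (B + 1) * (3 ^ K * (2 * N + 2) ^ (B * K)) := by
    have hs : Fintype.card SignType = 3 := rfl
    simp only [I, Fintype.card_prod, Fintype.card_fun, Fintype.card_fin, hs]
    push_cast
    rw [← pow_mul, mul_comm K B]
  calc atError allocStar Csuf P N T
      ≤ ((rewardLaw P).prod (Measure.infinitePi fun _ : ℕ × ℕ =>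
          (volume : Measure unitInterval))) ((⋃ q, E q) ×ˢ Set.univ) := measure_mono hsub
    _ = rewardLaw P (⋃ q, E q) := by rw [Measure.prod_prod, measure_univ, mul_one]
    _ ≤ ∑ q, rewardLaw P (E q) := measure_iUnion_fintype_le _ _
    _ ≤ ∑ _q : I, ENNReal.ofReal (Real.exp (-(y / 32))) :=
        Finset.sum_le_sum fun q _ => deviationEvent_prob P _ _ _ hy0
    _ = ENNReal.ofReal ((Fintype.card I : ℝ) * Real.exp (-(y / 32))) := by
        rw [Finset.sum_const, Finset.card_univ, nsmul_eq_mul,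
          ENNReal.ofReal_mul (Nat.cast_nonneg _), ENNReal.ofReal_natCast]
    _ = _ := by
        rw [hcard]
        congr 1
        have h1 : ((B : ℝ) + 1) * (3 ^ K * (2 * N + 2) ^ (B * K)) =
            Real.exp (Real.log (B + 1) + K * Real.log 3 + B * K * Real.log (2 * N + 2)) := by
          rw [Real.exp_add, Real.exp_add, Real.exp_log (by positivity), ← Real.log_pow,
            Real.exp_log (by positivity), ← Nat.cast_mul, ← Real.log_pow,
            Real.exp_log (by positivity), mul_assoc]
        rw [h1, ← Real.exp_add]
        congr 1
        ring

theorem le_liminf_atError (hK : 100 ≤ Real.log K) {Csuf : ℝ} (hC0 : 0 < Csuf) (hC1 : Csuf < 1)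
    {N : ℕ → ℕ} (hN : Tendsto N atTop atTop)
    (hNT : Tendsto (fun T : ℕ => (N T : ℝ) / (T : ℝ)) atTop (𝓝 0)) :
    ((1 / (3584 * (K * Real.log (Real.log K))) : ℝ) : EReal) ≤
      liminf (errorExponent fun T => atError allocStar Csuf (logInstance K) (N T) T) atTop := by
  have hKr : (0 : ℝ) < K := by exact_mod_cast pos_of_log hK
  have hll := one_le_log_log hK
  set κ := 1 / (3584 * (K * Real.log (Real.log K))) with hκ
  have hκ0 : 0 < κ := by positivity
  refine le_liminf_errorExponent (y := fun T => ((T : ℝ) - N T) * κ -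
    (Real.log (T + 1) + K * Real.log 3 + T / N T * K * Real.log (2 * N T + 2))) ?_ ?_
  · filter_upwards [hN.eventually_ge_atTop (2 * K), hNT.eventually_lt_const
      (show (0 : ℝ) < 1 / 8 by norm_num), eventually_gt_atTop 0] with T h1 h2 h3
    have hT : (0 : ℝ) < T := by exact_mod_cast h3
    have hN0 : 0 < N T := by have := pos_of_log hK; omega
    have hNr : (0 : ℝ) < N T := by exact_mod_cast hN0
    have h8 : 8 ≤ T / N T := by
      rw [Nat.le_div_iff_mul_le hN0]
      rw [div_lt_iff₀ hT] at h2
      have : (8 : ℝ) * N T ≤ T := by linarith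
      exact_mod_cast this
    refine (atError_le hK hC0 hC1 h1 h8).trans (ENNReal.ofReal_le_ofReal (Real.exp_le_exp.2
      (neg_le_neg ?_)))
    have hB1 : ((T / N T : ℕ) : ℝ) ≤ T / N T := Nat.cast_div_le
    have hB2 : (T : ℝ) - N T ≤ (T / N T : ℕ) * N T := by
      have h4 : T < T / N T * N T + N T := Nat.lt_div_mul_add hN0
      have h5 : (T : ℝ) < (T / N T : ℕ) * N T + N T := by exact_mod_cast h4
      linarith
    have hB3 : ((T / N T : ℕ) : ℝ) ≤ T := by exact_mod_cast Nat.div_le_self _ _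
    have hdev : deviationBudget K (N T) (T / N T) / 32 = (T / N T : ℕ) * N T * κ := by
      rw [deviationBudget, hκ]; field_simp; norm_num
    rw [hdev]
    have hlog0 : 0 ≤ Real.log (2 * N T + 2) := Real.log_nonneg (by linarith)
    gcongr
  · have h1 : Tendsto (fun x : ℝ => Real.log x / x) atTop (𝓝 0) :=
      Real.isLittleO_log_id_atTop.tendsto_div_nhds_zero
    have hT1 : Tendsto (fun T : ℕ => (T : ℝ) + 1) atTop atTop :=
      tendsto_atTop_add_const_right _ _ tendsto_natCast_atTop_atTop
    have hinv : Tendsto (fun T : ℕ => 1 / (T : ℝ)) atTop (𝓝 0) :=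
      tendsto_const_nhds.div_atTop tendsto_natCast_atTop_atTop
    have hNr : Tendsto (fun T : ℕ => (N T : ℝ)) atTop atTop :=
      tendsto_natCast_atTop_atTop.comp hN
    have hN2 : Tendsto (fun T : ℕ => 2 * (N T : ℝ) + 2) atTop atTop :=
      tendsto_atTop_add_const_right _ _ (hNr.const_mul_atTop (by norm_num))
    have hNinv : Tendsto (fun T : ℕ => 2 / (N T : ℝ)) atTop (𝓝 0) :=
      tendsto_const_nhds.div_atTop hNr
    have hlim := ((hNT.const_sub 1).mul_const κ).sub ((((h1.comp hT1).mul (hinv.const_add 1)).add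
      (hinv.const_mul (K * Real.log 3))).add
      (((h1.comp hN2).mul (hNinv.const_add 2)).const_mul (K : ℝ)))
    have e : (1 - 0) * κ - (0 * (1 + 0) + K * Real.log 3 * 0 + K * (0 * (2 + 0))) = κ := by ring
    rw [e] at hlim
    refine hlim.congr' ?_
    filter_upwards [eventually_gt_atTop 0, hN.eventually_gt_atTop 0] with T h2 h3
    have hT : (0 : ℝ) < T := by exact_mod_cast h2
    have hN0 : (0 : ℝ) < N T := by exact_mod_cast h3
    simp only [Function.comp_apply]
    field_simp

end almostTrackingError

theorem mainTheorem7 :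
    ∃ K₀ : ℕ,
      (∃ c : ℝ, 0 < c ∧ ∀ K : ℕ, K₀ ≤ K →
        (∀ Q : Fin K → ℝ, Misidentified (logInstance K) Q →
          c / Real.log (Real.log K) ≤ stblS Q (logInstance K) / normZ Q) ∧
        (0 < srRate (logInstance K) ∧
          Tendsto (errorExponent (srError (logInstance K))) atTop
            (𝓝 ((srRate (logInstance K) : ℝ) : EReal))) ∧
        c * (Real.log K / Real.log (Real.log K)) * srRate (logInstance K) ≤
          guaranteedRate allocStar (logInstance K)) ∧
      (∀ Csuf : ℝ, 0 < Csuf → Csuf < 1 →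
        ∃ c : ℝ, 0 < c ∧ ∀ K : ℕ, K₀ ≤ K →
          ∀ N : ℕ → ℕ, Tendsto N atTop atTop →
            Tendsto (fun T : ℕ => (N T : ℝ) / (T : ℝ)) atTop (𝓝 0) →
            ((c * (Real.log K / Real.log (Real.log K)) * srRate (logInstance K) : ℝ) : EReal) ≤
              liminf (errorExponent fun T => atError allocStar Csuf (logInstance K) (N T) T)
                atTop) := by
  have hlog : ∀ K : ℕ, ⌈Real.exp 100⌉₊ ≤ K → 100 ≤ Real.log K := by
    intro K hK
    have h1 : Real.exp 100 ≤ K := Nat.ceil_le.1 hK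
    exact (Real.le_log_iff_exp_le ((Real.exp_pos _).trans_le h1)).2 h1
  refine ⟨⌈Real.exp 100⌉₊, ⟨1 / 3200, by norm_num, fun K hK0 => ?_⟩,
    fun Csuf hC0 hC1 => ⟨1 / 14336, by norm_num, fun K hK0 N hN hNT => ?_⟩⟩
  · have hK := hlog K hK0
    have hll := one_le_log_log hK
    refine ⟨fun Q hQ => le_trans ?_ (le_stblS_div_normZ hK hQ),
      ⟨srRate_pos hK, tendsto_srError hK⟩, ?_⟩
    · exact div_le_div_of_nonneg_right (by norm_num) (by linarith)
    · refine ((mul_srRate_le hK (by norm_num)).trans (le_of_eq ?_)).trans (le_guaranteedRate hK)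
      norm_num
  · have hK := hlog K hK0
    refine le_trans (EReal.coe_le_coe_iff.2 ?_) (le_liminf_atError hK hC0 hC1 hN hNT)
    refine (mul_srRate_le hK (by norm_num)).trans (le_of_eq ?_)
    have hKr : (0 : ℝ) < K := by exact_mod_cast pos_of_log hK
    have hll := one_le_log_log hK
    field_simp
    norm_num
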